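/- Let $r\ge 2$, $p>0$, $\tau\ge 0$. Data are vectors $v\in\mathbb{R}_{\ge 0}^r$, and the quantity to estimate is $R_p(v)=(\max(v)-\min(v))^p$. In coordinated (shared-seed) PPS sampling with all thresholds equal to $\tau$, a seed $u$ is drawn uniformly from $(0,1]$ and the outcome $S=S(u,v)$ consists of $u$ and the values $v_i$ of all sampled entries $i$, where $i$ is sampled iff $v_i\ge\tau u$; we write $i\in S$, and $|S|$ for the number of sampled entries. Let $S^*$ be the set of data vectors $z$ consistent with $S$ ($z_i=v_i$ for $i\in S$ and $z_i<\tau u$ for $i\notin S$), and let $\underline{R}_p(u,v)=\inf_{z\in S^*(u,v)}R_p(z)$ (also for $u=0$, where every entry is sampled). An estimator is a real function $f$ of the outcome; $f(u,v)$ denotes $f(S(u,v))$. It is nonnegative if $f(u,v)\ge 0$ for all data $v$ and $u\in(0,1]$, and unbiased if for all data $v$ it is integrable in $u$ with $\int_0^1 f(u,v)\,du=R_p(v)$. Its variance on $v$ is that of $f(u,v)$ with $u$ uniform on $(0,1]$. Define the estimator $\hat R(S)$, for an outcome $S$ with seed $\zeta\in(0,1]$, by the first case that applies, where $m=\max_{i\in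 S}v_i$, $n=0$ if $|S|<r$ and $n=\min_{i\in S}v_i$ if $|S|=r$, and $\eta_0=\frac{p\tau-m}{(p-1)\tau}$: 1. $|S|=0$: $\hat R=0$. 2. $n\ge\tau$: $\hat R=(m-n)^p$. 3. $p\le 1$: $\hat R=m^p\frac{\tau}{\min\{m,\tau\}}$ if $n=0$, and $\hat R=\frac{\tau}{n}\Big((m-n)^p-\frac{\min\{m,\tau\}-n}{\min\{m,\tau\}}m^p\Big)$ otherwise. 4. $m\le\tau$ (and $p>1$): $\hat R=p\tau(m-\zeta\tau)^{p-1}$ if $\zeta\tau>n$, and $\hat R=0$ otherwise. 5. $\eta_0\in(0,1)$ (and $p>1$, $n<\tau<m$): $\hat R=\frac{(m-\eta_0\tau)^p}{1-\eta_0}$ if $\zeta\ge\max\{\eta_0,n/\tau\}$; else $\hat R=p\tau(m-\zeta\tau)^{p-1}$ if $n/\tau<\zeta<\eta_0$; else $\hat R=0$ if $\zeta\le n/\tau\le\eta_0$; else $\hat R=\frac{\tau(m-n)^p}{n}-\frac{(\tau-n)(m-\eta_0\tau)^p}{n(1-\eta_0)}$. 6. Otherwise ($p>1$, $n<\tau<m$,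 $\eta_0\notin(0,1)$): $\hat R=m^p$ if $\zeta\tau>n$, and $\hat R=\frac{\tau}{n}(m-n)^p-m^p\left(\frac{\tau}{n}-1\right)$ otherwise. Then: (a) The integral equation $$f(\zeta,v)=\sup_{z\in S^*(\zeta,v)}\ \inf_{0\le\eta<\zeta}\ \frac{\underline{R}_p(\eta,z)-\int_\zeta^1 f(u,v)\,du}{\zeta-\eta}\qquad\text{for all data } v \text{ and all } \zeta\in(0,1],$$ for estimators $f$ such that $f(\cdot,v)$ is integrable on $[\zeta,1]$ for all data $v$ and all $\zeta\in(0,1]$ (supremum and infimum in the extended reals), has exactly one solution $U$ (as a function on the outcomes $S(\zeta,v)$), the U estimator. One has $\hat R(\zeta,v)=U(\zeta,v)$ for all data $v$ and all $\zeta\in(0,1]$, except at the single seed $\zeta=\min(v)/\tau$ for data with $p>1$, $\tau<\max(v)<p\tau$ and $\frac{p\tau-\max(v)}{(p-1)\tau}\le\frac{\min(v)}{\tau}<1$. In particular, for each $v$ they agree for almost every seed. (b) $\hat R$ is nonnegative and unbiased, and its variance is finite on all data. (c) $\hat R$ is admissible: no nonnegative unbiased estimator has the same or lower variance on all data and strictly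 lower variance on some data. (d) $\hat R$ is order optimal with data of larger range first: no nonnegative unbiased estimator has strictly lower variance than $\hat R$ on some data $v$ and at most the variance of $\hat R$ on all data $z$ with $R_p(z)>R_p(v)$. (e) On every $v$ with $\min(v)=0$, the variance of $\hat R$ is at most that of any nonnegative unbiased estimator. -/

import Mathlib

open MeasureTheory ProbabilityTheory

noncomputable section

namespace SharedSeed

/-- The largest entry of a data vector. -/
def vmax {r : ℕ} (v : Fin r → ℝ) : ℝ := ⨆ i, v i

/-- The smallest entry of a data vector. -/
def vmin {r : ℕ} (v : Fin r → ℝ) : ℝ := ⨅ i, v i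

/-- The exponentiated range `(max v - min v) ^ p`. -/
def rangeP {r : ℕ} (p : ℝ) (v : Fin r → ℝ) : ℝ := (vmax v - vmin v) ^ p

/-- An outcome of shared-seed sampling: the seed, and for every entry either its value
(if it was sampled) or nothing. -/
structure Outcome (r : ℕ) where
  seed : ℝ
  entry : Fin r → Option ℝ

/-- The set of (indices of) sampled entries. -/
def Outcome.sampled {r : ℕ} (S : Outcome r) : Finset (Fin r) :=
  Finset.univ.filter fun i => (S.entry i).isSome

/-- The value of a sampled entry (only used for sampled entries). -/
def Outcome.value {r : ℕ} (S : Outcome r) (i : Fin r) : ℝ := (S.entry i).getD 0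

/-- The outcome `S(u, v)`: entry `i` is sampled iff `v i ≥ τ u`. -/
def outcome {r : ℕ} (τ u : ℝ) (v : Fin r → ℝ) : Outcome r where
  seed := u
  entry i := if τ * u ≤ v i then some (v i) else none

/-- `S*`: the nonnegative data vectors that are consistent with the outcome `S`. -/
def consistent {r : ℕ} (τ : ℝ) (S : Outcome r) : Set (Fin r → ℝ) :=
  {z | (∀ i, 0 ≤ z i) ∧ (∀ i ∈ S.sampled, z i = S.value i) ∧
    ∀ i ∉ S.sampled, z i < τ * S.seed}

/-- The lower bound function: the infimum of the exponentiated range over `S*`. -/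
def lowerBound {r : ℕ} (p τ : ℝ) (S : Outcome r) : ℝ :=
  sInf (rangeP p '' consistent τ S)

/-- The case-based estimator. -/
def rangeU {r : ℕ} (p τ : ℝ) (S : Outcome r) : ℝ :=
  let ζ : ℝ := S.seed
  let m : ℝ := ⨆ i : {i // i ∈ S.sampled}, S.value i
  let n : ℝ := if S.sampled.card < r then 0 else ⨅ i : {i // i ∈ S.sampled}, S.value i
  let η₀ : ℝ := (p * τ - m) / ((p - 1) * τ)
  if S.sampled.card = 0 then 0
  else if τ ≤ n then (m - n) ^ p
  else if p ≤ 1 then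
    if n = 0 then m ^ p * (τ / min m τ)
    else τ / n * ((m - n) ^ p - (min m τ - n) / min m τ * m ^ p)
  else if m ≤ τ then
    if n < ζ * τ then p * τ * (m - ζ * τ) ^ (p - 1)
    else 0
  else if 0 < η₀ ∧ η₀ < 1 then
    if max η₀ (n / τ) ≤ ζ then (m - η₀ * τ) ^ p / (1 - η₀)
    else if n / τ < ζ ∧ ζ < η₀ then p * τ * (m - ζ * τ) ^ (p - 1)
    else if ζ ≤ n / τ ∧ n / τ ≤ η₀ then 0
    else τ * (m - n) ^ p / n - (τ - n) * (m - η₀ * τ) ^ p / (n * (1 - η₀))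
  else
    if n < ζ * τ then m ^ p
    else τ / n * (m - n) ^ p - m ^ p * (τ / n - 1)

/-- The integral equation of the U estimator, required at all outcomes `S(ζ, v)`:
`f(ζ, v) = sup_{z ∈ S*} inf_{0 ≤ η < ζ} (lb(η, z) - ∫_ζ^1 f(u, v) du) / (ζ - η)`.
The supremum and the infimum are taken in the extended reals. -/
def SolvesUEquation {r : ℕ} (p τ : ℝ) (f : Outcome r → ℝ) : Prop :=
  ∀ v : Fin r → ℝ, (∀ i, 0 ≤ v i) → ∀ ζ ∈ Set.Ioc (0 : ℝ) 1,
    IntervalIntegrable (fun u => f (outcome τ u v)) volume ζ 1 ∧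
    (f (outcome τ ζ v) : EReal) =
      ⨆ z ∈ consistent τ (outcome τ ζ v), ⨅ η ∈ Set.Ico (0 : ℝ) ζ,
        (((lowerBound p τ (outcome τ η z) - ∫ u in ζ..1, f (outcome τ u v)) / (ζ - η) : ℝ) :
          EReal)

/-- The seeds `ζ = min(v) / τ ∈ [η₀, 1)`, for `p > 1` and `τ < max(v) < p τ`: here the
conditions of two branches of `rangeU` hold together and their values differ. -/
def IsTie {r : ℕ} (p τ ζ : ℝ) (v : Fin r → ℝ) : Prop :=
  1 < p ∧ τ < vmax v ∧ vmax v < p * τ ∧ ζ * τ = vmin v ∧ ζ < 1 ∧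
    (p * τ - vmax v) / ((p - 1) * τ) ≤ ζ

/-- The law of the seed: uniform on `(0, 1]`. -/
def seedLaw : Measure ℝ := volume.restrict (Set.Ioc 0 1)

/-- The estimator is nonnegative on all possible outcomes. -/
def IsNonneg {r : ℕ} (τ : ℝ) (f : Outcome r → ℝ) : Prop :=
  ∀ v : Fin r → ℝ, (∀ i, 0 ≤ v i) → ∀ u ∈ Set.Ioc (0 : ℝ) 1, 0 ≤ f (outcome τ u v)

/-- The estimator is unbiased for the exponentiated range, on all data. -/
def IsUnbiased {r : ℕ} (p τ : ℝ) (f : Outcome r → ℝ) : Prop :=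
  ∀ v : Fin r → ℝ, (∀ i, 0 ≤ v i) →
    Integrable (fun u => f (outcome τ u v)) seedLaw ∧
    ∫ u, f (outcome τ u v) ∂seedLaw = rangeP p v

/-- The variance of the estimator on data `v`, in `[0, ∞]`. -/
def estVar {r : ℕ} (τ : ℝ) (f : Outcome r → ℝ) (v : Fin r → ℝ) : ENNReal :=
  evariance (fun u => f (outcome τ u v)) seedLaw

/-- No nonnegative unbiased estimator has the same or lower variance on all data and strictly
lower variance on some data. -/
def IsAdmissible {r : ℕ} (p τ : ℝ) (f : Outcome r → ℝ) : Prop :=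
  ¬ ∃ g : Outcome r → ℝ, IsNonneg τ g ∧ IsUnbiased p τ g ∧
    (∀ v : Fin r → ℝ, (∀ i, 0 ≤ v i) → estVar τ g v ≤ estVar τ f v) ∧
    ∃ v : Fin r → ℝ, (∀ i, 0 ≤ v i) ∧ estVar τ g v < estVar τ f v

/-- Order optimality, when data with larger range precede: no nonnegative unbiased estimator
has strictly lower variance on some data `v` and at most the variance of `f` on all data with a
larger range than `v`. -/
def IsRangeOrderOptimal {r : ℕ} (p τ : ℝ) (f : Outcome r → ℝ) : Prop :=
  ¬ ∃ g : Outcome r → ℝ, IsNonneg τ g ∧ IsUnbiased p τ g ∧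
    ∃ v : Fin r → ℝ, (∀ i, 0 ≤ v i) ∧ estVar τ g v < estVar τ f v ∧
      ∀ z : Fin r → ℝ, (∀ i, 0 ≤ z i) → rangeP p v < rangeP p z →
        estVar τ g z ≤ estVar τ f z

end SharedSeed

end

/-!
Let `m` and `n` be the maximum and the minimum of the data `v`, and
`L η = max 0 (m - τ η) ^ p`.

**The estimator.** As unsampled entries may lie anywhere below `τ η`, the lower bound at seed `η`
is `max 0 (m - max n (τ η)) ^ p` (`lowerBound_le`, `le_lowerBound`, `lowerBound_eq_rangeP`). While
some but not all entries are sampled, the supremum in the integral equation is attained where all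
unsampled entries are `0`, and the equation says that the accumulated estimate `∫_ζ^1 f`, as a
function of `ζ`, is the lower convex hull of `L` and the point `(1, 0)`. This `hull` follows `L` up
to a point `contact` and then a chord (for `p ≤ 1` and for `m ≥ p τ` it is the chord alone); its
negated derivative `slope` is the estimate. When all entries are sampled, the estimate is a
constant, `level`, which makes the estimator unbiased. This gives the solution `uEst`
(`uEst_solves`), and `rangeU` is the same function in closed form, except at ties, which are a null
set for each `v` (`rangeU_outcome`, `rangeU_ae_eq`).

**Uniqueness.** The right-hand side of the integral equation decreases in `∫_ζ^1 f`. Hence the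
difference of the accumulated estimates of two solutions, which is `0` at seed `1`, cannot grow
when the seed decreases (`SolvesUEquation.integral_le`).

**Optimality.** Let `g` be nonnegative and unbiased. Its accumulated estimate at `ζ` is at most the
range of any consistent data, hence at most the lower bound
(`IsUnbiased.integral_le_lowerBound`). Suppose `n = 0`, and let `f` be the U estimate on `v`, a
decreasing function of the seed. Each superlevel set of `f` is an initial interval that ends
at seed `1` or where the hull equals the lower bound (`exists_superlevel_slope`), so `g - f` has
nonnegative integral over it; by the layer-cake formula `∫ f (g - f) ≥ 0`
(`inner_nonneg_of_vmin_eq_zero`).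
Then `∫ g ^ 2 ≥ ∫ f ^ 2 + ∫ (g - f) ^ 2`, so `f` has the least variance, and uniquely so
(`evariance_le_and_ae_eq`).
For general `v` with `n > 0`, lower the entries equal to `n` to `0`. This enlarges the range and
leaves the outcomes at seeds `u > n / τ` unchanged, so a `g` whose variance on data of larger range
is no larger agrees with `f` almost everywhere on these seeds. On the remaining seeds `f` is
constant and `g` has the same integral, so the variance of `f` on `v` is no larger
(`evariance_uVal_le`). This is order optimality, which implies admissibility.
-/

noncomputable section

namespace SharedSeed

/-! ### The lower hull of the curve `(m - τ η) ^ p` and the point `(1, 0)` -/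

/-- The seed above which no entry of data with maximum `m` is sampled, capped at `1`. -/
def reach (τ m : ℝ) : ℝ := min (m / τ) 1

/-- The seed at which the lower hull leaves the curve `(m - τ η) ^ p`: to the left of it the hull
is the curve, to the right it is the chord that ends at `(reach τ m, 0)`. -/
def contact (p τ m : ℝ) : ℝ :=
  if p ≤ 1 then 0 else if m ≤ τ then m / τ else max 0 ((p * τ - m) / ((p - 1) * τ))

/-- The negated slope of the linear part of the hull; it is `0 / 0 = 0` when that part is empty. -/
def chord (p τ m : ℝ) : ℝ := (m - τ * contact p τ m) ^ p / (reach τ m - contact p τ m)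

/-- The lower convex hull on `[0, 1]` of the curve `max 0 (m - τ η) ^ p` and the point `(1, 0)`. It is
the estimate accumulated on the seeds above `ζ` for data with maximum `m` and minimum `0`. -/
def hull (p τ m ζ : ℝ) : ℝ :=
  if ζ ≤ contact p τ m then (m - τ * ζ) ^ p else chord p τ m * max 0 (reach τ m - ζ)

/-- The negated derivative of `hull` (from the left at the end of the chord): the estimate when
not all entries are sampled. -/
def slope (p τ m ζ : ℝ) : ℝ :=
  if ζ < contact p τ m then p * τ * (m - τ * ζ) ^ (p - 1)
  else if ζ ≤ reach τ m then chord p τ m else 0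

section Hull

variable {p τ m : ℝ}

lemma reach_le_one : reach τ m ≤ 1 := min_le_right _ _

lemma reach_nonneg (hτ : 0 < τ) (hm : 0 ≤ m) : 0 ≤ reach τ m :=
  le_min (by positivity) zero_le_one

lemma mul_reach_le (hτ : 0 < τ) : τ * reach τ m ≤ m := by
  calc τ * reach τ m ≤ τ * (m / τ) := by gcongr; exact min_le_left _ _
    _ = m := by field_simp

lemma le_reach {ζ : ℝ} (hτ : 0 < τ) (h : τ * ζ ≤ m) (h1 : ζ ≤ 1) : ζ ≤ reach τ m :=
  le_min ((le_div_iff₀ hτ).2 (by linarith)) h1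

lemma reach_of_le (hτ : 0 < τ) (h : m ≤ τ) : reach τ m = m / τ :=
  min_eq_left ((div_le_one hτ).2 h)

lemma reach_of_ge (hτ : 0 < τ) (h : τ ≤ m) : reach τ m = 1 :=
  min_eq_right ((one_le_div hτ).2 h)

/-- At `reach`, either the seeds are exhausted or the curve has come down to `0`. -/
lemma reach_eq_one_or (hτ : 0 < τ) : reach τ m = 1 ∨ m - τ * reach τ m = 0 := by
  rcases le_total m τ with h | h
  · right; rw [reach_of_le hτ h]; field_simp; ring
  · left; exact reach_of_ge hτ h

lemma contact_nonneg (hτ : 0 < τ) (hm : 0 ≤ m) : 0 ≤ contact p τ m := by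
  unfold contact; split_ifs
  · exact le_rfl
  · positivity
  · exact le_max_left _ _

lemma one_lt_of_contact_pos (h : 0 < contact p τ m) : 1 < p := by
  by_contra hp
  simp [contact, not_lt.1 hp] at h

lemma contact_le_reach (hτ : 0 < τ) (hm : 0 ≤ m) : contact p τ m ≤ reach τ m := by
  unfold contact; split_ifs with h1 h2
  · exact reach_nonneg hτ hm
  · rw [reach_of_le hτ h2]
  · push Not at h1 h2
    rw [reach_of_ge hτ h2.le]
    refine max_le zero_le_one ((div_le_one (mul_pos (by linarith) hτ)).2 (by linarith))

lemma contact_eq_tangency (hp : 1 < p) (h2 : τ < m)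
    (h3 : 0 < (p * τ - m) / ((p - 1) * τ)) :
    contact p τ m = (p * τ - m) / ((p - 1) * τ) := by
  rw [contact, if_neg (not_le.2 hp), if_neg (not_le.2 h2), max_eq_right h3.le]

lemma contact_eq_zero (h2 : τ < m) (h3 : (p * τ - m) / ((p - 1) * τ) ≤ 0) :
    contact p τ m = 0 := by
  rw [contact, if_neg (not_le.2 h2), max_eq_left h3, ite_self]

lemma curve_base_nonneg {ζ : ℝ} (hτ : 0 < τ) (h : ζ ≤ reach τ m) : 0 ≤ m - τ * ζ := by
  have := mul_reach_le (m := m) hτ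
  have := mul_le_mul_of_nonneg_left h hτ.le
  linarith

lemma chord_nonneg (hτ : 0 < τ) (hm : 0 ≤ m) : 0 ≤ chord p τ m := by
  have := contact_le_reach (p := p) hτ hm
  exact div_nonneg (Real.rpow_nonneg (curve_base_nonneg hτ this) _) (by linarith)

/-- The convex power function lies above its tangents. -/
lemma rpow_tangent_le {p x y : ℝ} (hp : 1 < p) (hx : 0 ≤ x) (hy : 0 ≤ y) :
    x ^ p + p * x ^ (p - 1) * (y - x) ≤ y ^ p := by
  rcases hx.eq_or_lt with rfl | hx
  · rw [Real.zero_rpow (by linarith), Real.zero_rpow (by linarith)]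
    simpa using Real.rpow_nonneg hy p
  · have h := one_add_mul_self_le_rpow_one_add (s := y / x - 1) (p := p)
      (by have : 0 ≤ y / x := by positivity
          linarith) hp.le
    have hxp : 0 < x ^ p := by positivity
    have e : x ^ (p - 1) = x ^ p / x := by rw [Real.rpow_sub hx, Real.rpow_one]
    have e2 : (1 + (y / x - 1)) ^ p = y ^ p / x ^ p := by
      rw [← Real.div_rpow hy hx.le]; congr 1; ring
    rw [e2, le_div_iff₀ hxp] at h
    calc x ^ p + p * x ^ (p - 1) * (y - x) = (1 + p * (y / x - 1)) * x ^ p := by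
          rw [e]; field_simp
      _ ≤ y ^ p := h

/-- The chord starts on the curve. -/
lemma curve_contact (hp : 0 < p) (hτ : 0 < τ) :
    (m - τ * contact p τ m) ^ p = chord p τ m * (reach τ m - contact p τ m) := by
  rcases eq_or_ne (reach τ m - contact p τ m) 0 with h | h
  · have hb : contact p τ m = reach τ m := by linarith
    rw [h, mul_zero]
    rcases reach_eq_one_or (m := m) hτ with h1 | h1
    · have hm0 : m = τ := by
        rw [h1] at hb
        unfold contact at hb; split_ifs at hb with h2 h3
        · norm_num at hb
        · field_simp at hb; linarith
        · push Not at h2 h3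
          exfalso
          have : (p * τ - m) / ((p - 1) * τ) < 1 :=
            (div_lt_one (mul_pos (by linarith) hτ)).2 (by linarith)
          have := max_lt one_pos this
          linarith
      rw [hb, h1, hm0, mul_one, sub_self, Real.zero_rpow hp.ne']
    · rw [hb, h1, Real.zero_rpow hp.ne']
  · rw [chord]; field_simp

/-- Where the hull leaves the curve inside the interval, it does so along the tangent. -/
lemma chord_eq_tangent (hτ : 0 < τ) (hb : 0 < contact p τ m) :
    chord p τ m = p * τ * (m - τ * contact p τ m) ^ (p - 1) := by
  have hp := one_lt_of_contact_pos hb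
  rcases le_or_gt m τ with h | h
  · have e : contact p τ m = m / τ := by rw [contact, if_neg (not_le.2 hp), if_pos h]
    have e2 : m - τ * (m / τ) = 0 := by field_simp; ring
    rw [chord, e, e2, Real.zero_rpow (by linarith), Real.zero_rpow (by linarith)]; simp
  · rw [chord, reach_of_ge hτ h.le]
    have h3 : 0 < (p * τ - m) / ((p - 1) * τ) := by
      rw [contact, if_neg (not_le.2 hp), if_neg (not_le.2 h)] at hb
      simpa using hb
    have hp1 : 0 < p - 1 := by linarith
    rw [contact_eq_tangency hp h h3]
    have e1 : m - τ * ((p * τ - m) / ((p - 1) * τ)) = p * (m - τ) / (p - 1) := by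
      field_simp; ring
    have e2 : 1 - (p * τ - m) / ((p - 1) * τ) = (m - τ) / ((p - 1) * τ) := by
      field_simp; ring
    have hmt : 0 < m - τ := by linarith
    have hx : 0 < p * (m - τ) / (p - 1) := by positivity
    rw [e1, e2, Real.rpow_sub hx, Real.rpow_one]
    generalize (p * (m - τ) / (p - 1)) ^ p = X
    field_simp

/-- The line through the chord lies below the curve. -/
lemma line_le_curve {η : ℝ} (hp : 0 < p) (hτ : 0 < τ) (hm : 0 ≤ m) (h0 : 0 ≤ η)
    (h1 : η ≤ reach τ m) : chord p τ m * (reach τ m - η) ≤ (m - τ * η) ^ p := by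
  have hb0 := contact_nonneg (p := p) hτ hm
  have hba := contact_le_reach (p := p) hτ hm
  have hy := curve_base_nonneg hτ h1
  rcases hb0.eq_or_lt with hb | hb
  · rcases (reach_nonneg hτ hm).eq_or_lt with ha | ha
    · rw [← ha] at h1 ⊢
      obtain rfl : η = 0 := le_antisymm h1 h0
      simpa using Real.rpow_nonneg hm p
    have hmpos : 0 < m := by
      have := mul_reach_le (m := m) hτ
      have := mul_pos hτ ha
      linarith
    have e : chord p τ m * (reach τ m - η) = m ^ p * (1 - η / reach τ m) := by
      rw [chord, ← hb, mul_zero, sub_zero, sub_zero]; field_simp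
    have e2 : (m - τ * η) ^ p = m ^ p * (1 - τ * η / m) ^ p := by
      have h : 0 ≤ 1 - τ * η / m := by
        rw [sub_nonneg, div_le_one hmpos]; linarith
      rw [← Real.mul_rpow hm h]; congr 1; field_simp
    rw [e, e2]
    gcongr
    have hra : η / reach τ m ≤ 1 := (div_le_one ha).2 h1
    rcases le_or_gt p 1 with hp1 | hp1
    · have hle : 1 - η / reach τ m ≤ 1 - τ * η / m := by
        have : τ * η / m ≤ η / reach τ m := by
          rw [div_le_div_iff₀ hmpos ha]
          nlinarith [mul_reach_le (m := m) hτ]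
        linarith
      calc 1 - η / reach τ m ≤ (1 - η / reach τ m) ^ p := by
            apply Real.self_le_rpow_of_le_one <;> first | linarith | skip
            have : 0 ≤ η / reach τ m := by positivity
            linarith
        _ ≤ _ := Real.rpow_le_rpow (by linarith) hle hp.le
    · have hmτ : τ < m := by
        by_contra h
        rw [contact, if_neg (not_le.2 hp1), if_pos (not_lt.1 h)] at hb
        have : 0 < m / τ := by positivity
        linarith
      have hpm : p * τ ≤ m := by
        by_contra h
        rw [contact, if_neg (not_le.2 hp1), if_neg (not_le.2 hmτ)] at hb
        have : 0 < (p * τ - m) / ((p - 1) * τ) :=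
          div_pos (by linarith) (mul_pos (by linarith) hτ)
        have := le_max_right 0 ((p * τ - m) / ((p - 1) * τ))
        linarith
      have hB := one_add_mul_self_le_rpow_one_add (s := -(τ * η / m)) (p := p)
        (by rw [neg_le_neg_iff, div_le_one hmpos]; linarith) hp1.le
      have : p * (τ * η / m) ≤ η := by
        rw [← mul_div_assoc, div_le_iff₀ hmpos]; nlinarith
      rw [reach_of_ge hτ hmτ.le, div_one]
      rw [← sub_eq_add_neg] at hB
      linarith
  · have hp1 := one_lt_of_contact_pos hb
    have ht := rpow_tangent_le hp1 (curve_base_nonneg hτ hba) hy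
    rw [curve_contact hp hτ] at ht
    have := chord_eq_tangent hτ hb
    calc chord p τ m * (reach τ m - η)
        = chord p τ m * (reach τ m - contact p τ m) +
            chord p τ m * (contact p τ m - η) := by ring
      _ = chord p τ m * (reach τ m - contact p τ m) +
            p * (m - τ * contact p τ m) ^ (p - 1) * (m - τ * η - (m - τ * contact p τ m)) := by
        nth_rewrite 2 [this]
        rw [show m - τ * η - (m - τ * contact p τ m) = τ * (contact p τ m - η) by ring]
        ring
      _ ≤ _ := ht

lemma hull_zero (hτ : 0 < τ) (hm : 0 ≤ m) : hull p τ m 0 = m ^ p := by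
  rw [hull, if_pos (contact_nonneg hτ hm)]; simp

lemma hull_of_le {ζ : ℝ} (h : ζ ≤ contact p τ m) : hull p τ m ζ = (m - τ * ζ) ^ p := if_pos h

lemma hull_of_contact_le {ζ : ℝ} (hp : 0 < p) (hτ : 0 < τ)
    (h : contact p τ m ≤ ζ) (h1 : ζ ≤ reach τ m) :
    hull p τ m ζ = chord p τ m * (reach τ m - ζ) := by
  rcases h.eq_or_lt with h | h
  · rw [← h, hull_of_le le_rfl, curve_contact hp hτ]
  · rw [hull, if_neg (not_le.2 h), max_eq_right (by linarith)]

lemma hull_of_reach_le {ζ : ℝ} (hp : 0 < p) (hτ : 0 < τ) (hm : 0 ≤ m) (h : reach τ m ≤ ζ) :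
    hull p τ m ζ = 0 := by
  rcases h.eq_or_lt with h | h
  · rw [← h, hull_of_contact_le hp hτ (contact_le_reach hτ hm) le_rfl]; simp
  · rw [hull, if_neg (not_le.2 ((contact_le_reach hτ hm).trans_lt h)),
      max_eq_left (by linarith), mul_zero]

lemma hull_le_curve {ζ : ℝ} (hp : 0 < p) (hτ : 0 < τ) (hm : 0 ≤ m) (h0 : 0 ≤ ζ)
    (h1 : ζ ≤ reach τ m) : hull p τ m ζ ≤ (m - τ * ζ) ^ p := by
  rcases le_total ζ (contact p τ m) with h | h
  · rw [hull_of_le h]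
  · rw [hull_of_contact_le hp hτ h h1]; exact line_le_curve hp hτ hm h0 h1

lemma slope_of_le {ζ : ℝ} (hτ : 0 < τ) (hm : 0 ≤ m) (h0 : 0 < ζ) (h : ζ ≤ contact p τ m) :
    slope p τ m ζ = p * τ * (m - τ * ζ) ^ (p - 1) := by
  rcases h.eq_or_lt with h | h
  · rw [slope, if_neg (by linarith), if_pos (h ▸ contact_le_reach hτ hm),
      chord_eq_tangent hτ (by linarith), ← h]
  · rw [slope, if_pos h]

lemma slope_of_contact_le {ζ : ℝ} (h : contact p τ m ≤ ζ) (h1 : ζ ≤ reach τ m) :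
    slope p τ m ζ = chord p τ m := by
  rw [slope, if_neg (not_lt.2 h), if_pos h1]

lemma slope_of_reach_lt {ζ : ℝ} (hτ : 0 < τ) (hm : 0 ≤ m) (h : reach τ m < ζ) :
    slope p τ m ζ = 0 := by
  rw [slope, if_neg (not_lt.2 ((contact_le_reach hτ hm).trans h.le)), if_neg (not_le.2 h)]

lemma slope_nonneg {ζ : ℝ} (hp : 0 < p) (hτ : 0 < τ) (hm : 0 ≤ m) : 0 ≤ slope p τ m ζ := by
  unfold slope; split_ifs with h
  · have := curve_base_nonneg hτ (h.le.trans (contact_le_reach hτ hm))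
    positivity
  · exact chord_nonneg hτ hm
  · exact le_rfl

lemma chord_le_slope {ζ : ℝ} (hτ : 0 < τ) (hm : 0 ≤ m) (h0 : 0 < ζ)
    (h : ζ ≤ contact p τ m) : chord p τ m ≤ slope p τ m ζ := by
  have hb := h0.trans_le h
  have hp := one_lt_of_contact_pos hb
  rw [slope_of_le hτ hm h0 h, chord_eq_tangent hτ hb]
  have := curve_base_nonneg hτ (contact_le_reach (p := p) hτ hm)
  gcongr

lemma slope_anti_of_le_contact {x y : ℝ} (hτ : 0 < τ) (hm : 0 ≤ m) (hx : 0 < x) (hxy : x ≤ y)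
    (h : y ≤ contact p τ m) : slope p τ m y ≤ slope p τ m x := by
  have hp := one_lt_of_contact_pos ((hx.trans_le hxy).trans_le h)
  rw [slope_of_le hτ hm hx (hxy.trans h), slope_of_le hτ hm (hx.trans_le hxy) h]
  have := curve_base_nonneg hτ (h.trans (contact_le_reach hτ hm))
  gcongr

/-- A bound for `slope`, uniform in the seed. -/
lemma slope_le_bound {ζ : ℝ} (hp : 0 < p) (hτ : 0 < τ) (hm : 0 ≤ m) (h0 : 0 ≤ ζ) :
    slope p τ m ζ ≤ chord p τ m + p * τ * m ^ (p - 1) := by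
  have hc := chord_nonneg (p := p) hτ hm
  have hd : 0 ≤ p * τ * m ^ (p - 1) := by positivity
  unfold slope; split_ifs with h
  · have hp1 := one_lt_of_contact_pos (h0.trans_lt h)
    have hy := curve_base_nonneg hτ (h.le.trans (contact_le_reach hτ hm))
    have : (m - τ * ζ) ^ (p - 1) ≤ m ^ (p - 1) :=
      Real.rpow_le_rpow hy (by nlinarith) (by linarith)
    have := mul_le_mul_of_nonneg_left this (mul_pos hp hτ).le
    linarith
  · linarith
  · linarith

lemma measurable_slope : Measurable (slope p τ m) := by
  unfold slope
  refine Measurable.ite measurableSet_Iio ?_ (Measurable.ite measurableSet_Iic ?_ ?_) <;>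
    fun_prop

lemma intervalIntegrable_slope {x y : ℝ} (hp : 0 < p) (hτ : 0 < τ) (hm : 0 ≤ m)
    (hx : 0 ≤ x) (hy : 0 ≤ y) : IntervalIntegrable (slope p τ m) volume x y := by
  refine (intervalIntegrable_const (c := chord p τ m + p * τ * m ^ (p - 1))).mono_fun'
    measurable_slope.aestronglyMeasurable ?_
  refine (ae_restrict_iff' measurableSet_uIoc).2 (.of_forall fun u hu => ?_)
  beta_reduce
  rw [Real.norm_of_nonneg (slope_nonneg hp hτ hm)]
  exact slope_le_bound hp hτ hm ((le_min hx hy).trans hu.1.le)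

/-- `slope` is the negated derivative of `hull`, which vanishes at seed `1`. -/
lemma integral_slope {ζ : ℝ} (hp : 0 < p) (hτ : 0 < τ) (hm : 0 ≤ m) (h0 : 0 ≤ ζ)
    (h1 : ζ ≤ 1) : ∫ u in ζ..1, slope p τ m u = hull p τ m ζ := by
  have hI : ∀ x y, 0 ≤ x → 0 ≤ y → IntervalIntegrable (slope p τ m) volume x y :=
    fun x y => intervalIntegrable_slope hp hτ hm
  have hb0 := contact_nonneg (p := p) hτ hm
  have hba := contact_le_reach (p := p) hτ hm
  have ha0 := reach_nonneg hτ hm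
  have hA : ∀ x, reach τ m ≤ x → x ≤ 1 → ∫ u in x..1, slope p τ m u = 0 := by
    intro x hx hx1
    rw [intervalIntegral.integral_congr_Ioo_of_le (g := fun _ => 0) hx1 fun u hu =>
      slope_of_reach_lt hτ hm (hx.trans_lt hu.1)]
    simp
  have hB : ∀ x, contact p τ m ≤ x → x ≤ reach τ m →
      ∫ u in x..1, slope p τ m u = chord p τ m * (reach τ m - x) := by
    intro x hx hx1
    rw [← intervalIntegral.integral_add_adjacent_intervals (b := reach τ m)
      (hI _ _ (hb0.trans hx) ha0) (hI _ _ ha0 zero_le_one), hA _ le_rfl reach_le_one,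
      intervalIntegral.integral_congr_Ioo_of_le (g := fun _ => chord p τ m) hx1 fun u hu =>
        slope_of_contact_le (hx.trans hu.1.le) hu.2.le]
    simp; ring
  rcases le_total (reach τ m) ζ with h | h
  · rw [hA _ h h1, hull_of_reach_le hp hτ hm h]
  rcases le_or_gt (contact p τ m) ζ with h' | h'
  · rw [hB _ h' h, hull_of_contact_le hp hτ h' h]
  have hp1 := one_lt_of_contact_pos (h0.trans_lt h')
  rw [← intervalIntegral.integral_add_adjacent_intervals (b := contact p τ m)
    (hI _ _ h0 hb0) (hI _ _ hb0 zero_le_one), hB _ le_rfl hba, ← curve_contact hp hτ,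
    hull_of_le h'.le]
  have key : ∫ u in ζ..contact p τ m, slope p τ m u =
      -(m - τ * contact p τ m) ^ p - -(m - τ * ζ) ^ p := by
    rw [intervalIntegral.integral_congr_Ioo_of_le
      (g := fun u => p * τ * (m - τ * u) ^ (p - 1)) h'.le fun u hu =>
        slope_of_le hτ hm (h0.trans_lt hu.1) hu.2.le]
    · refine intervalIntegral.integral_eq_sub_of_hasDerivAt (f := fun u => -(m - τ * u) ^ p)
        (fun u _ => ?_) (Continuous.intervalIntegrable ?_ _ _)
      · have h := (((hasDerivAt_id u).const_mul τ).const_sub m).rpow_const (p := p)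
          (Or.inr hp1.le)
        exact h.neg.congr_deriv (by simp only [id]; ring)
      · exact continuous_const.mul
          ((by fun_prop : Continuous fun u => m - τ * u).rpow_const fun _ => Or.inr (by linarith))
  rw [key]; ring

/-- The hull, extended to the left along its slope at `ζ`, stays below the curve. -/
lemma slope_mul_le {ζ η : ℝ} (hp : 0 < p) (hτ : 0 < τ) (hm : 0 ≤ m) (h0 : 0 ≤ η)
    (h : η < ζ) (h1 : ζ ≤ reach τ m) :
    slope p τ m ζ * (ζ - η) ≤ (m - τ * η) ^ p - hull p τ m ζ := by
  rcases le_total ζ (contact p τ m) with hb | hb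
  · have hp1 := one_lt_of_contact_pos ((h0.trans_lt h).trans_le hb)
    rw [slope_of_le hτ hm (h0.trans_lt h) hb, hull_of_le hb]
    have := rpow_tangent_le hp1 (curve_base_nonneg hτ h1) (curve_base_nonneg hτ (h.le.trans h1))
    linarith
  · rw [slope_of_contact_le hb h1, hull_of_contact_le hp hτ hb h1]
    have := line_le_curve hp hτ hm h0 (h.le.trans h1)
    linarith

/-- The slope at `ζ` is the largest one for which `slope_mul_le` holds. -/
lemma exists_quotient_le_slope {ζ ε : ℝ} (hp : 0 < p) (hτ : 0 < τ) (hm : 0 ≤ m) (h0 : 0 < ζ)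
    (h1 : ζ ≤ reach τ m) (hε : 0 < ε) :
    ∃ η ∈ Set.Ico 0 ζ, ((m - τ * η) ^ p - hull p τ m ζ) / (ζ - η) ≤ slope p τ m ζ + ε := by
  rcases le_or_gt ζ (contact p τ m) with hb | hb
  · have hp1 := one_lt_of_contact_pos (h0.trans_le hb)
    have hc : Continuous fun η => p * τ * (m - τ * η) ^ (p - 1) :=
      continuous_const.mul
        ((by fun_prop : Continuous fun u => m - τ * u).rpow_const fun _ => Or.inr (by linarith))
    have ev : ∀ᶠ η in nhdsWithin ζ (Set.Iio ζ),
        p * τ * (m - τ * η) ^ (p - 1) < slope p τ m ζ + ε := by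
      refine (hc.tendsto ζ).mono_left nhdsWithin_le_nhds |>.eventually_lt_const ?_
      rw [slope_of_le hτ hm h0 hb]; linarith
    have ev2 : ∀ᶠ η in nhdsWithin ζ (Set.Iio ζ), η ∈ Set.Ico 0 ζ := Ico_mem_nhdsLT h0
    obtain ⟨η, h2, h3⟩ := (ev.and ev2).exists
    refine ⟨η, h3, le_trans ?_ h2.le⟩
    rw [hull_of_le hb, div_le_iff₀ (by linarith [h3.2])]
    have := rpow_tangent_le hp1 (curve_base_nonneg hτ (h3.2.le.trans h1)) (curve_base_nonneg hτ h1)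
    linarith
  · refine ⟨contact p τ m, ⟨contact_nonneg hτ hm, hb⟩, ?_⟩
    rw [slope_of_contact_le hb.le h1, hull_of_contact_le hp hτ hb.le h1,
      curve_contact hp hτ]
    have : chord p τ m * (reach τ m - contact p τ m) - chord p τ m * (reach τ m - ζ) =
      chord p τ m * (ζ - contact p τ m) := by ring
    rw [this, mul_div_assoc, div_self (by linarith)]
    linarith

end Hull

/-! ### Data, outcomes and lower bounds -/

section Data

variable {r : ℕ} {p τ : ℝ}

lemma le_vmax (v : Fin r → ℝ) (i : Fin r) : v i ≤ vmax v :=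
  le_ciSup (Set.finite_range v).bddAbove i

lemma vmin_le (v : Fin r → ℝ) (i : Fin r) : vmin v ≤ v i :=
  ciInf_le (Set.finite_range v).bddBelow i

lemma mem_sampled {u : ℝ} {v : Fin r → ℝ} {i : Fin r} :
    i ∈ (outcome τ u v).sampled ↔ τ * u ≤ v i := by
  unfold Outcome.sampled outcome
  rw [Finset.mem_filter]
  dsimp only
  split_ifs with h <;> simp [h]

lemma value_outcome {u : ℝ} {v : Fin r → ℝ} {i : Fin r} (h : τ * u ≤ v i) :
    (outcome τ u v).value i = v i := by
  simp [Outcome.value, outcome, h]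

lemma mem_consistent {u : ℝ} {v z : Fin r → ℝ} :
    z ∈ consistent τ (outcome τ u v) ↔
      (∀ i, 0 ≤ z i) ∧ (∀ i, τ * u ≤ v i → z i = v i) ∧ ∀ i, v i < τ * u → z i < τ * u := by
  simp only [consistent, Set.mem_ofPred_eq, mem_sampled, not_le]
  refine and_congr_right fun _ => and_congr_left fun _ => forall₂_congr fun i h => ?_
  rw [value_outcome h]

lemma self_mem_consistent {u : ℝ} {v : Fin r → ℝ} (hv : ∀ i, 0 ≤ v i) :
    v ∈ consistent τ (outcome τ u v) :=
  mem_consistent.2 ⟨hv, fun _ _ => rfl, fun _ h => h⟩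

/-- Consistent data have the same outcomes at all larger seeds. -/
lemma outcome_eq_of_consistent {ζ u : ℝ} {v z : Fin r → ℝ} (hτ : 0 ≤ τ)
    (hz : z ∈ consistent τ (outcome τ ζ v)) (hu : ζ ≤ u) : outcome τ u z = outcome τ u v := by
  obtain ⟨-, h1, h2⟩ := mem_consistent.1 hz
  have hle : τ * ζ ≤ τ * u := mul_le_mul_of_nonneg_left hu hτ
  simp only [outcome, Outcome.mk.injEq, true_and]
  funext i
  rcases le_or_gt (τ * ζ) (v i) with h | h
  · rw [h1 i h]
  · rw [if_neg (not_le.2 ((h2 i h).trans_le hle)), if_neg (not_le.2 (h.trans_le hle))]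

/-- If all entries are sampled, then the data are determined. -/
lemma eq_of_mem_consistent {u : ℝ} {v z : Fin r → ℝ} (h : τ * u ≤ vmin v)
    (hz : z ∈ consistent τ (outcome τ u v)) : z = v :=
  funext fun i => (mem_consistent.1 hz).2.1 i (h.trans (vmin_le v i))

/-- The data `v` with the entries that are unsampled at seed `ζ` replaced by `0`. -/
def zeroUnsampled (τ ζ : ℝ) (v : Fin r → ℝ) : Fin r → ℝ := fun i => if τ * ζ ≤ v i then v i else 0

lemma zeroUnsampled_nonneg {ζ : ℝ} {v : Fin r → ℝ} (hv : ∀ i, 0 ≤ v i) (i : Fin r) :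
    0 ≤ zeroUnsampled τ ζ v i := by
  unfold zeroUnsampled; split_ifs
  exacts [hv i, le_rfl]

lemma zeroUnsampled_mem_consistent {ζ : ℝ} {v : Fin r → ℝ} (hv : ∀ i, 0 ≤ v i) :
    zeroUnsampled τ ζ v ∈ consistent τ (outcome τ ζ v) := by
  refine mem_consistent.2 ⟨zeroUnsampled_nonneg hv, fun i h => if_pos h, fun i h => ?_⟩
  rw [zeroUnsampled, if_neg (not_le.2 h)]
  exact (hv i).trans_lt h

lemma lowerBound_eq_rangeP {u : ℝ} {v : Fin r → ℝ} (hv : ∀ i, 0 ≤ v i) (h : τ * u ≤ vmin v) :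
    lowerBound p τ (outcome τ u v) = rangeP p v := by
  have : consistent τ (outcome τ u v) = {v} :=
    Set.eq_singleton_iff_unique_mem.2 ⟨self_mem_consistent hv, fun _ => eq_of_mem_consistent h⟩
  rw [lowerBound, this, Set.image_singleton, csInf_singleton]

variable [Nonempty (Fin r)]

lemma exists_eq_vmax (v : Fin r → ℝ) : ∃ i, v i = vmax v := exists_eq_ciSup_of_finite

lemma exists_eq_vmin (v : Fin r → ℝ) : ∃ i, v i = vmin v := exists_eq_ciInf_of_finite

lemma vmax_le {v : Fin r → ℝ} {x : ℝ} (h : ∀ i, v i ≤ x) : vmax v ≤ x := ciSup_le h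

lemma le_vmin {v : Fin r → ℝ} {x : ℝ} (h : ∀ i, x ≤ v i) : x ≤ vmin v := le_ciInf h

lemma vmin_le_vmax (v : Fin r → ℝ) : vmin v ≤ vmax v := by
  obtain ⟨i, hi⟩ := exists_eq_vmax v
  exact hi ▸ vmin_le v i

lemma rangeP_nonneg (v : Fin r → ℝ) : 0 ≤ rangeP p v :=
  Real.rpow_nonneg (sub_nonneg.2 (vmin_le_vmax v)) p

lemma vmax_eq_of_consistent {u : ℝ} {v z : Fin r → ℝ} (h : τ * u ≤ vmax v)
    (hz : z ∈ consistent τ (outcome τ u v)) : vmax z = vmax v := by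
  obtain ⟨-, h1, h2⟩ := mem_consistent.1 hz
  apply le_antisymm
  · refine vmax_le fun i => ?_
    rcases le_or_gt (τ * u) (v i) with hi | hi
    · rw [h1 i hi]; exact le_vmax v i
    · exact (h2 i hi).le.trans h
  · obtain ⟨i, hi⟩ := exists_eq_vmax v
    rw [← hi, ← h1 i (hi ▸ h)]
    exact le_vmax z i

lemma bddBelow_rangeP_image (A : Set (Fin r → ℝ)) : BddBelow (rangeP p '' A) :=
  ⟨0, by rintro _ ⟨z, -, rfl⟩; exact rangeP_nonneg z⟩

lemma lowerBound_nonneg (S : Outcome r) : 0 ≤ lowerBound p τ S :=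
  Real.sInf_nonneg (by rintro _ ⟨z, -, rfl⟩; exact rangeP_nonneg z)

/-- The unsampled entries may be arbitrarily close to `τ u`. -/
lemma lowerBound_le {u : ℝ} {v : Fin r → ℝ} (hp : 0 < p) (hv : ∀ i, 0 ≤ v i) :
    lowerBound p τ (outcome τ u v) ≤ max 0 (vmax v - τ * u) ^ p := by
  have key : ∀ ε > 0, lowerBound p τ (outcome τ u v) ≤ (max 0 (vmax v - τ * u) + ε) ^ p := by
    intro ε hε
    let w : Fin r → ℝ := fun i => if τ * u ≤ v i then v i else max (v i) (τ * u - ε)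
    have hw : w ∈ consistent τ (outcome τ u v) := by
      refine mem_consistent.2 ⟨fun i => ?_, fun i hi => if_pos hi, fun i hi => ?_⟩
      · simp only [w]; split_ifs
        · exact hv i
        · exact le_max_of_le_left (hv i)
      · simp only [w, if_neg (not_le.2 hi)]
        exact max_lt hi (by linarith)
    refine (csInf_le (bddBelow_rangeP_image _) (Set.mem_image_of_mem _ hw)).trans ?_
    refine Real.rpow_le_rpow (sub_nonneg.2 (vmin_le_vmax w)) ?_ hp.le
    have h1 : vmax w ≤ max (vmax v) (τ * u) := by
      refine vmax_le fun i => ?_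
      simp only [w]; split_ifs
      · exact le_max_of_le_left (le_vmax v i)
      · exact max_le_max (le_vmax v i) (by linarith)
    have h2 : τ * u - ε ≤ vmin w := by
      refine le_vmin fun i => ?_
      simp only [w]; split_ifs
      · linarith
      · exact le_max_right _ _
    have h3 : max (vmax v) (τ * u) = max 0 (vmax v - τ * u) + τ * u := by
      rw [← max_add_add_right, max_comm]
      simp
    linarith
  have hc : Continuous fun ε : ℝ => (max 0 (vmax v - τ * u) + ε) ^ p :=
    (by fun_prop : Continuous fun ε : ℝ => max 0 (vmax v - τ * u) + ε).rpow_const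
      fun _ => Or.inr hp.le
  have ht := (hc.tendsto 0).mono_left (nhdsWithin_le_nhds (s := Set.Ioi 0))
  rw [add_zero] at ht
  exact ge_of_tendsto ht (eventually_nhdsWithin_of_forall key)

lemma le_lowerBound {u : ℝ} {v : Fin r → ℝ} (hp : 0 < p) (hv : ∀ i, 0 ≤ v i)
    (h : τ * u ≤ vmax v) :
    (vmax v - max (vmin v) (τ * u)) ^ p ≤ lowerBound p τ (outcome τ u v) := by
  refine le_csInf ⟨_, Set.mem_image_of_mem _ (self_mem_consistent hv)⟩ ?_
  rintro _ ⟨z, hz, rfl⟩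
  refine Real.rpow_le_rpow (sub_nonneg.2 (max_le (vmin_le_vmax v) h)) ?_ hp.le
  rw [vmax_eq_of_consistent h hz]
  obtain ⟨-, h1, h2⟩ := mem_consistent.1 hz
  obtain ⟨i, hi⟩ := exists_eq_vmin v
  have : z i ≤ max (vmin v) (τ * u) := by
    rcases le_or_gt (τ * u) (v i) with h' | h'
    · rw [h1 i h', hi]; exact le_max_left _ _
    · exact le_max_of_le_right (h2 i h').le
  linarith [vmin_le z i]

lemma vmin_zeroUnsampled {ζ : ℝ} {v : Fin r → ℝ} (hv : ∀ i, 0 ≤ v i) (h : vmin v < τ * ζ) :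
    vmin (zeroUnsampled τ ζ v) = 0 := by
  refine le_antisymm ?_ (le_vmin (zeroUnsampled_nonneg hv))
  obtain ⟨i, hi⟩ := exists_eq_vmin v
  have := vmin_le (zeroUnsampled τ ζ v) i
  rwa [zeroUnsampled, if_neg (by linarith)] at this

/-- An outcome in which some entry is sampled shows the maximum of the data. -/
lemma iSup_sampled {u : ℝ} {v : Fin r → ℝ} (h : τ * u ≤ vmax v) :
    (⨆ i : {i // i ∈ (outcome τ u v).sampled}, (outcome τ u v).value i) = vmax v := by
  obtain ⟨i, hi⟩ := exists_eq_vmax v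
  have hmem : i ∈ (outcome τ u v).sampled := mem_sampled.2 (hi ▸ h)
  have : Nonempty {i // i ∈ (outcome τ u v).sampled} := ⟨⟨i, hmem⟩⟩
  apply le_antisymm
  · refine ciSup_le fun j => ?_
    rw [value_outcome (mem_sampled.1 j.2)]
    exact le_vmax v j
  · have := le_ciSup (f := fun i : {i // i ∈ (outcome τ u v).sampled} =>
      (outcome τ u v).value i) (Set.finite_range _).bddAbove ⟨i, hmem⟩
    rwa [value_outcome (mem_sampled.1 hmem), hi] at this

/-- An outcome in which all entries are sampled shows the minimum of the data. -/
lemma iInf_sampled {u : ℝ} {v : Fin r → ℝ} (h : τ * u ≤ vmin v) :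
    (⨅ i : {i // i ∈ (outcome τ u v).sampled}, (outcome τ u v).value i) = vmin v := by
  have hmem : ∀ i, i ∈ (outcome τ u v).sampled := fun i => mem_sampled.2 (h.trans (vmin_le v i))
  obtain ⟨i, hi⟩ := exists_eq_vmin v
  have : Nonempty {i // i ∈ (outcome τ u v).sampled} := ⟨⟨i, hmem i⟩⟩
  apply le_antisymm
  · have := ciInf_le (f := fun i : {i // i ∈ (outcome τ u v).sampled} =>
      (outcome τ u v).value i) (Set.finite_range _).bddBelow ⟨i, hmem i⟩
    rwa [value_outcome (mem_sampled.1 (hmem i)), hi] at this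
  · refine le_ciInf fun j => ?_
    rw [value_outcome (mem_sampled.1 j.2)]
    exact vmin_le v j

lemma card_sampled_eq_zero_iff {u : ℝ} {v : Fin r → ℝ} :
    (outcome τ u v).sampled.card = 0 ↔ vmax v < τ * u := by
  rw [Finset.card_eq_zero, Finset.eq_empty_iff_forall_notMem]
  simp only [mem_sampled, not_le]
  refine ⟨fun h => ?_, fun h i => (le_vmax v i).trans_lt h⟩
  obtain ⟨i, hi⟩ := exists_eq_vmax v
  exact hi ▸ h i

lemma card_sampled_lt_iff {u : ℝ} {v : Fin r → ℝ} :
    (outcome τ u v).sampled.card < r ↔ vmin v < τ * u := by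
  have : (outcome τ u v).sampled.card < r ↔ (outcome τ u v).sampled ≠ Finset.univ := by
    rw [Ne, ← Finset.card_eq_iff_eq_univ, Fintype.card_fin]
    have := Finset.card_le_univ (outcome τ u v).sampled
    rw [Fintype.card_fin] at this
    omega
  rw [this, Ne, Finset.eq_univ_iff_forall]
  simp only [mem_sampled]
  push Not
  refine ⟨fun ⟨i, hi⟩ => (vmin_le v i).trans_lt hi, fun h => ?_⟩
  obtain ⟨i, hi⟩ := exists_eq_vmin v
  exact ⟨i, hi ▸ h⟩

end Data

/-! ### The estimates of the U estimator as a function of the seed -/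

/-- The constant estimate on the seeds at which all entries of data with maximum `m` and minimum
`n` are sampled: what `hull` leaves to be estimated, spread evenly over these seeds. For
`n = 0 < τ` there are no such seeds in `(0, 1]`, and the value is `0 / 0 = 0`. -/
def level (p τ m n : ℝ) : ℝ :=
  if τ ≤ n then (m - n) ^ p else ((m - n) ^ p - hull p τ m (n / τ)) / (n / τ)

/-- The U estimate for data with maximum `m` and minimum `n`, as a function of the seed. -/
def uVal (p τ m n ζ : ℝ) : ℝ := if n < τ * ζ then slope p τ m ζ else level p τ m n

/-- The U estimator. With `n = 0` for an unknown minimum, `uVal` takes the value `slope`. -/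
def uEst {r : ℕ} (p τ : ℝ) (S : Outcome r) : ℝ :=
  if S.sampled.card = 0 then 0
  else uVal p τ (⨆ i : {i // i ∈ S.sampled}, S.value i)
    (if S.sampled.card < r then 0 else ⨅ i : {i // i ∈ S.sampled}, S.value i) S.seed

section Profile

variable {p τ m n : ℝ}

lemma uVal_of_lt {ζ : ℝ} (h : n < τ * ζ) : uVal p τ m n ζ = slope p τ m ζ := if_pos h

lemma uVal_of_le {ζ : ℝ} (h : τ * ζ ≤ n) : uVal p τ m n ζ = level p τ m n := if_neg (not_lt.2 h)

lemma level_of_le (h : τ ≤ n) : level p τ m n = (m - n) ^ p := if_pos h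

lemma level_nonneg (hp : 0 < p) (hn : 0 ≤ n) (hnm : n ≤ m) :
    0 ≤ level p τ m n := by
  unfold level; split_ifs with h
  · exact Real.rpow_nonneg (by linarith) p
  · have hτ' : 0 < τ := by linarith
    refine div_nonneg ?_ (by positivity)
    have h1 : n / τ ≤ reach τ m :=
      le_reach hτ' (by field_simp; exact hnm) ((div_le_one hτ').2 (by linarith))
    have h2 := hull_le_curve hp hτ' (hn.trans hnm) (by positivity : 0 ≤ n / τ) h1
    have e : τ * (n / τ) = n := by field_simp
    rw [e] at h2
    linarith

lemma uVal_nonneg {ζ : ℝ} (hp : 0 < p) (hτ : 0 ≤ τ) (hn : 0 ≤ n) (hnm : n ≤ m) :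
    0 ≤ uVal p τ m n ζ := by
  unfold uVal; split_ifs with h
  · rcases hτ.eq_or_lt with rfl | hτ'
    · linarith
    · exact slope_nonneg hp hτ' (hn.trans hnm)
  · exact level_nonneg hp hn hnm

lemma uVal_le_bound {ζ : ℝ} (hp : 0 < p) (hτ : 0 ≤ τ) (hn : 0 ≤ n) (hnm : n ≤ m) (h0 : 0 ≤ ζ) :
    uVal p τ m n ζ ≤ max (chord p τ m + p * τ * m ^ (p - 1)) (level p τ m n) := by
  unfold uVal; split_ifs with h
  · rcases hτ.eq_or_lt with rfl | hτ'
    · linarith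
    · exact le_max_of_le_left (slope_le_bound hp hτ' (hn.trans hnm) h0)
  · exact le_max_right _ _

lemma measurable_uVal : Measurable (uVal p τ m n) := by
  unfold uVal
  exact Measurable.ite (measurableSet_lt measurable_const (by fun_prop)) measurable_slope
    measurable_const

lemma intervalIntegrable_uVal {x y : ℝ} (hp : 0 < p) (hτ : 0 ≤ τ) (hn : 0 ≤ n) (hnm : n ≤ m)
    (hx : 0 ≤ x) (hy : 0 ≤ y) : IntervalIntegrable (uVal p τ m n) volume x y := by
  refine (intervalIntegrable_const
    (c := max (chord p τ m + p * τ * m ^ (p - 1)) (level p τ m n))).mono_fun'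
    measurable_uVal.aestronglyMeasurable ?_
  refine (ae_restrict_iff' measurableSet_uIoc).2 (.of_forall fun u hu => ?_)
  beta_reduce
  rw [Real.norm_of_nonneg (uVal_nonneg hp hτ hn hnm)]
  exact uVal_le_bound hp hτ hn hnm ((le_min hx hy).trans hu.1.le)

lemma integral_uVal_of_le {ζ : ℝ} (hp : 0 < p) (hτ : 0 < τ) (hm : 0 ≤ m) (h0 : 0 ≤ ζ)
    (h1 : ζ ≤ 1) (h : n ≤ τ * ζ) : ∫ u in ζ..1, uVal p τ m n u = hull p τ m ζ := by
  rw [intervalIntegral.integral_congr_Ioo_of_le (g := slope p τ m) h1 fun u hu =>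
    uVal_of_lt (h.trans_lt (mul_lt_mul_of_pos_left hu.1 hτ)), integral_slope hp hτ hm h0 h1]

/-- While all entries are sampled, the accumulated estimate is affine in the seed, and it
reaches the exponentiated range at seed `0`. -/
lemma integral_uVal_of_ge {ζ : ℝ} (hp : 0 < p) (hτ : 0 ≤ τ) (hn : 0 ≤ n) (hnm : n ≤ m)
    (h0 : 0 ≤ ζ) (h1 : ζ ≤ 1) (h : τ * ζ ≤ n) :
    ∫ u in ζ..1, uVal p τ m n u = (m - n) ^ p - level p τ m n * ζ := by
  rcases le_or_gt τ n with hτn | hτn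
  · rw [intervalIntegral.integral_congr_Ioo_of_le (g := fun _ => level p τ m n) h1 fun u hu =>
      uVal_of_le ((mul_le_of_le_one_right hτ hu.2.le).trans hτn), level_of_le hτn]
    simp; ring
  · have hτ' : 0 < τ := by linarith
    have hd0 : 0 ≤ n / τ := by positivity
    have hd1 : n / τ ≤ 1 := (div_le_one hτ').2 hτn.le
    have hζd : ζ ≤ n / τ := (le_div_iff₀ hτ').2 (by linarith)
    have e : τ * (n / τ) = n := by field_simp
    have hI : ∀ x y, 0 ≤ x → 0 ≤ y → IntervalIntegrable (uVal p τ m n) volume x y :=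
      fun x y => intervalIntegrable_uVal hp hτ hn hnm
    rw [← intervalIntegral.integral_add_adjacent_intervals (b := n / τ) (hI _ _ h0 hd0)
      (hI _ _ hd0 zero_le_one), integral_uVal_of_le hp hτ' (hn.trans hnm) hd0 hd1 e.ge,
      intervalIntegral.integral_congr_Ioo_of_le (g := fun _ => level p τ m n) hζd fun u hu =>
      uVal_of_le (by rw [← e]; exact mul_le_mul_of_nonneg_left hu.2.le hτ)]
    have key : level p τ m n * (n / τ) = (m - n) ^ p - hull p τ m (n / τ) := by
      rcases hn.eq_or_lt with rfl | hn'
      · rw [zero_div, mul_zero, hull_zero hτ' hnm, sub_zero, sub_self]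
      · rw [level, if_neg (not_le.2 hτn), div_mul_cancel₀ _ (by positivity)]
    simp only [intervalIntegral.integral_const, smul_eq_mul]
    linarith

lemma integral_uVal (hp : 0 < p) (hτ : 0 ≤ τ) (hn : 0 ≤ n) (hnm : n ≤ m) :
    ∫ u in (0 : ℝ)..1, uVal p τ m n u = (m - n) ^ p := by
  rw [integral_uVal_of_ge hp hτ hn hnm le_rfl zero_le_one (by simpa using hn)]; simp

end Profile

/-! ### The integral equation and the uniqueness of its solution -/

section Solution

variable {r : ℕ} {p τ : ℝ}

/-- The right-hand side of the equation decreases in the accumulated estimate `∫_ζ^1 f`. So, on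
seeds where that of `f` exceeds that of `g`, the function `f` is at most `g`; going down from seed
`1`, the excess could never have come about. -/
theorem SolvesUEquation.integral_le {f g : Outcome r → ℝ} (hf : SolvesUEquation p τ f)
    (hg : SolvesUEquation p τ g) {v : Fin r → ℝ} (hv : ∀ i, 0 ≤ v i) {ζ : ℝ}
    (hζ : ζ ∈ Set.Ioc (0 : ℝ) 1) :
    ∫ u in ζ..1, f (outcome τ u v) ≤ ∫ u in ζ..1, g (outcome τ u v) := by
  by_contra! hlt
  set F : ℝ → ℝ := fun x => ∫ u in x..1, f (outcome τ u v)
  set G : ℝ → ℝ := fun x => ∫ u in x..1, g (outcome τ u v)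
  have hcont : ContinuousOn (fun x => F x - G x) (Set.Icc ζ 1) := by
    have hc : ∀ k : Outcome r → ℝ, SolvesUEquation p τ k →
        ContinuousOn (fun x => ∫ u in x..1, k (outcome τ u v)) (Set.Icc ζ 1) := by
      intro k hk
      have hI := (hk v hv ζ hζ).1
      have := intervalIntegral.continuousOn_primitive_interval_left
        ((intervalIntegrable_iff_integrableOn_Icc_of_le hζ.2).1 hI |>.mono_set (by
          rw [Set.uIcc_of_le hζ.2]))
      rwa [Set.uIcc_of_le hζ.2] at this
    exact (hc f hf).sub (hc g hg)
  -- the first seed above `ζ` where the excess is gone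
  set T := Set.Icc ζ 1 ∩ (fun x => F x - G x) ⁻¹' Set.Iic 0
  have hTc : IsClosed T := hcont.preimage_isClosed_of_isClosed isClosed_Icc isClosed_Iic
  have h1T : (1 : ℝ) ∈ T := ⟨⟨hζ.2, le_rfl⟩, by simp [F, G]⟩
  have hbdd : BddBelow T := ⟨ζ, fun x hx => hx.1.1⟩
  have hξ : sInf T ∈ T := hTc.csInf_mem ⟨1, h1T⟩ hbdd
  set ξ := sInf T
  have hle : ∀ u ∈ Set.Ioo ζ ξ, f (outcome τ u v) ≤ g (outcome τ u v) := by
    intro u hu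
    have hu1 : u ≤ 1 := hu.2.le.trans hξ.1.2
    have hu' : u ∈ Set.Ioc (0 : ℝ) 1 := ⟨hζ.1.trans hu.1, hu1⟩
    have hFG : G u ≤ F u := by
      by_contra! h
      exact absurd (csInf_le hbdd ⟨⟨hu.1.le, hu1⟩, by simpa using h.le⟩) (not_le.2 hu.2)
    rw [← EReal.coe_le_coe_iff, (hf v hv u hu').2, (hg v hv u hu').2]
    refine iSup₂_mono fun z _ => iInf₂_mono fun η hη => EReal.coe_le_coe_iff.2 ?_
    have : 0 < u - η := by linarith [hη.2]
    gcongr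
  have hsplit : ∀ k : Outcome r → ℝ, SolvesUEquation p τ k →
      IntervalIntegrable (fun u => k (outcome τ u v)) volume ζ ξ ∧
      ∫ u in ζ..1, k (outcome τ u v) =
        (∫ u in ζ..ξ, k (outcome τ u v)) + ∫ u in ξ..1, k (outcome τ u v) := by
    intro k hk
    have hI := (hk v hv ζ hζ).1
    have hI2 := (hk v hv ξ ⟨hζ.1.trans_le hξ.1.1, hξ.1.2⟩).1
    have hI1 := hI.trans hI2.symm
    exact ⟨hI1, (intervalIntegral.integral_add_adjacent_intervals hI1 hI2).symm⟩
  have hmono := intervalIntegral.integral_mono_on_of_le_Ioo hξ.1.1 (hsplit f hf).1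
    (hsplit g hg).1 hle
  have e1 := (hsplit f hf).2
  have e2 := (hsplit g hg).2
  have e3 : F ξ - G ξ ≤ 0 := hξ.2
  simp only [F, G] at e3
  linarith

theorem SolvesUEquation.unique {f g : Outcome r → ℝ} (hf : SolvesUEquation p τ f)
    (hg : SolvesUEquation p τ g) {v : Fin r → ℝ} (hv : ∀ i, 0 ≤ v i) {ζ : ℝ}
    (hζ : ζ ∈ Set.Ioc (0 : ℝ) 1) : f (outcome τ ζ v) = g (outcome τ ζ v) := by
  rw [← EReal.coe_eq_coe_iff, (hf v hv ζ hζ).2, (hg v hv ζ hζ).2,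
    le_antisymm (hf.integral_le hg hv hζ) (hg.integral_le hf hv hζ)]

variable [Nonempty (Fin r)]

lemma vmin_nonneg {v : Fin r → ℝ} (hv : ∀ i, 0 ≤ v i) : 0 ≤ vmin v := le_vmin hv

lemma vmax_nonneg {v : Fin r → ℝ} (hv : ∀ i, 0 ≤ v i) : 0 ≤ vmax v :=
  (vmin_nonneg hv).trans (vmin_le_vmax v)

lemma pos_of_vmin_lt {u : ℝ} {v : Fin r → ℝ} (hτ : 0 ≤ τ) (hv : ∀ i, 0 ≤ v i)
    (h : vmin v < τ * u) : 0 < τ := by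
  refine hτ.lt_of_ne fun h0 => ?_
  rw [← h0, zero_mul] at h
  exact absurd (vmin_nonneg hv) (not_le.2 h)

lemma uEst_outcome {ζ : ℝ} {v : Fin r → ℝ} (hτ : 0 ≤ τ) (hv : ∀ i, 0 ≤ v i)
    (h0 : 0 < ζ) :
    uEst p τ (outcome τ ζ v) = uVal p τ (vmax v) (vmin v) ζ := by
  have e : (outcome τ ζ v).seed = ζ := rfl
  unfold uEst
  rw [e]
  split_ifs with h1 h2
  · rw [card_sampled_eq_zero_iff] at h1
    have hn := (vmin_le_vmax v).trans_lt h1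
    have hτ' := pos_of_vmin_lt hτ hv hn
    rw [uVal_of_lt hn, slope_of_reach_lt hτ' (vmax_nonneg hv)]
    exact (min_le_left _ _).trans_lt ((div_lt_iff₀ hτ').2 (by linarith))
  · rw [card_sampled_eq_zero_iff, not_lt] at h1
    rw [card_sampled_lt_iff] at h2
    have hτ' := pos_of_vmin_lt hτ hv h2
    rw [iSup_sampled h1, uVal_of_lt h2, uVal_of_lt (by positivity)]
  · rw [card_sampled_eq_zero_iff, not_lt] at h1
    rw [card_sampled_lt_iff, not_lt] at h2
    rw [iSup_sampled h1, iInf_sampled h2]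

lemma intervalIntegrable_uEst {x y : ℝ} {v : Fin r → ℝ} (hp : 0 < p) (hτ : 0 ≤ τ)
    (hv : ∀ i, 0 ≤ v i) (hx : 0 ≤ x) (hy : 0 ≤ y) :
    IntervalIntegrable (fun u => uEst p τ (outcome τ u v)) volume x y :=
  (intervalIntegrable_uVal hp hτ (vmin_nonneg hv) (vmin_le_vmax v) hx hy).congr
    fun _ hu => (uEst_outcome hτ hv ((le_min hx hy).trans_lt hu.1)).symm

lemma integral_uEst {ζ : ℝ} {v : Fin r → ℝ} (hτ : 0 ≤ τ) (hv : ∀ i, 0 ≤ v i) (h0 : 0 ≤ ζ)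
    (h1 : ζ ≤ 1) : ∫ u in ζ..1, uEst p τ (outcome τ u v) =
      ∫ u in ζ..1, uVal p τ (vmax v) (vmin v) u :=
  intervalIntegral.integral_congr_Ioo_of_le h1 fun _ hu =>
    uEst_outcome hτ hv (h0.trans_lt hu.1)

/-- A criterion for the value of a supremum of infima. -/
lemma coe_eq_iSup_iInf {α : Type*} {A : Set α} {B : Set ℝ} {q : α → ℝ → ℝ} {x : ℝ}
    (h1 : ∃ z ∈ A, ∀ η ∈ B, x ≤ q z η) (h2 : ∀ z ∈ A, ∀ ε > 0, ∃ η ∈ B, q z η ≤ x + ε) :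
    (x : EReal) = ⨆ z ∈ A, ⨅ η ∈ B, (q z η : EReal) := by
  apply le_antisymm
  · obtain ⟨z, hz, h⟩ := h1
    exact le_iSup₂_of_le z hz (le_iInf₂ fun η hη => EReal.coe_le_coe_iff.2 (h η hη))
  · refine iSup₂_le fun z hz => le_of_not_gt fun hlt => ?_
    obtain ⟨y, hxy, hy⟩ := EReal.lt_iff_exists_real_btwn.1 hlt
    have hxy := EReal.coe_lt_coe_iff.1 hxy
    obtain ⟨η, hη, h⟩ := h2 z hz (y - x) (by linarith)
    have : (⨅ η ∈ B, (q z η : EReal)) ≤ y :=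
      iInf₂_le_of_le η hη (EReal.coe_le_coe_iff.2 (by linarith))
    exact absurd hy (not_lt.2 this)

theorem uEst_solves (hp : 0 < p) (hτ : 0 ≤ τ) :
    SolvesUEquation p τ (uEst p τ : Outcome r → ℝ) := by
  intro v hv ζ ⟨h0, h1⟩
  refine ⟨intervalIntegrable_uEst hp hτ hv h0.le zero_le_one, ?_⟩
  rw [integral_uEst hτ hv h0.le h1, uEst_outcome hτ hv h0]
  have hn := vmin_nonneg hv
  have hnm := vmin_le_vmax v
  have hm := hn.trans hnm
  rcases le_or_gt (τ * ζ) (vmin v) with hfull | hpart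
  · -- All entries are sampled: the data are known, and the infimum is attained at `η = 0`.
    rw [integral_uVal_of_ge hp hτ hn hnm h0.le h1 hfull, uVal_of_le hfull]
    have hk := level_nonneg (τ := τ) hp hn hnm
    have hlb : ∀ η ∈ Set.Ico 0 ζ, lowerBound p τ (outcome τ η v) -
        ((vmax v - vmin v) ^ p - level p τ (vmax v) (vmin v) * ζ) =
          level p τ (vmax v) (vmin v) * ζ := by
      intro η hη
      rw [lowerBound_eq_rangeP hv ((mul_le_mul_of_nonneg_left hη.2.le hτ).trans hfull), rangeP]
      ring
    apply coe_eq_iSup_iInf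
    · refine ⟨v, self_mem_consistent hv, fun η hη => ?_⟩
      rw [hlb η hη, le_div_iff₀ (by linarith [hη.2])]
      exact mul_le_mul_of_nonneg_left (by linarith [hη.1]) hk
    · intro z hz ε hε
      obtain rfl := eq_of_mem_consistent hfull hz
      refine ⟨0, ⟨le_rfl, h0⟩, ?_⟩
      rw [hlb 0 ⟨le_rfl, h0⟩, sub_zero, mul_div_cancel_right₀ _ h0.ne']
      linarith
  have hτ' := pos_of_vmin_lt hτ hv hpart
  rw [integral_uVal_of_le hp hτ' hm h0.le h1 hpart.le, uVal_of_lt hpart]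
  rcases le_or_gt (τ * ζ) (vmax v) with hsome | hnone
  · -- Some entries are sampled: the supremum is attained where all the others are `0`.
    have hζ := le_reach hτ' hsome h1
    apply coe_eq_iSup_iInf
    · have hz := zeroUnsampled_mem_consistent (τ := τ) (ζ := ζ) hv
      refine ⟨_, hz, fun η hη => ?_⟩
      rw [le_div_iff₀ (by linarith [hη.2])]
      refine (slope_mul_le hp hτ' hm hη.1 hη.2 hζ).trans (sub_le_sub_right ?_ _)
      have hmax := vmax_eq_of_consistent hsome hz
      have hle := le_lowerBound (τ := τ) (u := η) hp (zeroUnsampled_nonneg (τ := τ) (ζ := ζ) hv)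
        (by rw [hmax]; exact (mul_le_mul_of_nonneg_left hη.2.le hτ).trans hsome)
      rwa [hmax, vmin_zeroUnsampled hv hpart, max_eq_right (mul_nonneg hτ hη.1)] at hle
    · intro z hz ε hε
      obtain ⟨η, hη, h⟩ := exists_quotient_le_slope hp hτ' hm h0 hζ hε
      refine ⟨η, hη, le_trans ?_ h⟩
      have : 0 < ζ - η := by linarith [hη.2]
      gcongr
      have hle := lowerBound_le (τ := τ) (u := η) hp (mem_consistent.1 hz).1
      rwa [vmax_eq_of_consistent hsome hz, max_eq_right
        (curve_base_nonneg hτ' (hη.2.le.trans hζ))] at hle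
  · -- No entry is sampled: the lower bound vanishes just below `ζ`.
    have hζ : reach τ (vmax v) < ζ :=
      (min_le_left _ _).trans_lt ((div_lt_iff₀ hτ').2 (by linarith))
    rw [slope_of_reach_lt hτ' hm hζ, hull_of_reach_le hp hτ' hm hζ.le]
    apply coe_eq_iSup_iInf
    · refine ⟨v, self_mem_consistent hv, fun η hη => ?_⟩
      rw [sub_zero]
      exact div_nonneg (lowerBound_nonneg _) (by linarith [hη.2])
    · intro z hz ε hε
      obtain ⟨hz0, -, h2⟩ := mem_consistent.1 hz
      obtain ⟨i, hi⟩ := exists_eq_vmax z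
      have hzmax : vmax z < τ * ζ := hi ▸ h2 i ((le_vmax v i).trans_lt hnone)
      refine ⟨vmax z / τ, ⟨div_nonneg (vmax_nonneg hz0) hτ,
        (div_lt_iff₀ hτ').2 (by linarith)⟩, ?_⟩
      have hle := lowerBound_le (τ := τ) (u := vmax z / τ) hp hz0
      have e : τ * (vmax z / τ) = vmax z := by field_simp
      rw [e, sub_self, max_self, Real.zero_rpow hp.ne'] at hle
      rw [le_antisymm hle (lowerBound_nonneg _)]
      simpa using hε.le

end Solution

/-! ### Comparison of variances -/

section Variance

variable {Ω : Type*} [MeasurableSpace Ω] {μ : Measure Ω}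

/-- By the layer-cake formula, `∫ f h` is the integral over `t` of `∫_{t < f} h`. -/
lemma integral_mul_nonneg_of_superlevel [IsFiniteMeasure μ] {f h : Ω → ℝ} {C : ℝ}
    (hf : Measurable f) (hfC : ∀ᵐ x ∂μ, f x ∈ Set.Icc 0 C) (hh : Integrable h μ)
    (H : ∀ t ≥ 0, 0 ≤ ∫ x in {x | t < f x}, h x ∂μ) : 0 ≤ ∫ x, f x * h x ∂μ := by
  have hmeas : MeasurableSet {q : Ω × ℝ | q.2 < f q.1} :=
    measurableSet_lt measurable_snd (hf.comp measurable_fst)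
  have hint : Integrable (Function.uncurry fun x t => if t < f x then h x else 0)
      (μ.prod (volume.restrict (Set.Ioc 0 C))) := by
    refine ((hh.comp_fst (volume.restrict (Set.Ioc 0 C))).indicator hmeas).congr
      (.of_forall fun q => ?_)
    simp [Set.indicator_apply, Function.uncurry]
  have e1 : ∫ x, f x * h x ∂μ =
      ∫ x, (∫ t in Set.Ioc 0 C, if t < f x then h x else 0) ∂μ := by
    refine integral_congr_ae (hfC.mono fun x hx => ?_)
    have hset : Set.Ioc 0 C ∩ Set.Iio (f x) = Set.Ioo 0 (f x) := by
      ext t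
      simp only [Set.mem_inter_iff, Set.mem_Ioc, Set.mem_Iio, Set.mem_Ioo]
      exact ⟨fun h => ⟨h.1.1, h.2⟩, fun h => ⟨⟨h.1, h.2.le.trans hx.2⟩, h.2⟩⟩
    have : (fun t => if t < f x then h x else 0) = (Set.Iio (f x)).indicator fun _ => h x := by
      funext t; simp [Set.indicator_apply]
    beta_reduce
    rw [this, setIntegral_indicator measurableSet_Iio, hset, setIntegral_const]
    simp [hx.1]
  rw [e1, integral_integral_swap hint]
  refine setIntegral_nonneg measurableSet_Ioc fun t ht => ?_
  have : (fun x => if t < f x then h x else 0) = {x | t < f x}.indicator h := by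
    funext x; simp [Set.indicator_apply]
  rw [this, integral_indicator (measurableSet_lt measurable_const hf)]
  exact H t ht.1.le

/-- If `Y - X` has mean zero and does not correlate negatively with `X`, then
`E Y ^ 2 = E X ^ 2 + 2 E (X (Y - X)) + E (Y - X) ^ 2` shows that `X` has the smaller variance. -/
lemma evariance_le_and_ae_eq [IsProbabilityMeasure μ] {X Y : Ω → ℝ} (hX : MemLp X 2 μ)
    (hY : Integrable Y μ) (hmean : ∫ x, X x ∂μ = ∫ x, Y x ∂μ)
    (hinner : 0 ≤ ∫ x, X x * (Y x - X x) ∂μ) :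
    evariance X μ ≤ evariance Y μ ∧ (evariance Y μ ≤ evariance X μ → Y =ᵐ[μ] X) := by
  by_cases hY2 : MemLp Y 2 μ
  · have hD : MemLp (fun x => Y x - X x) 2 μ := hY2.sub hX
    have hexp : Var[Y; μ] = Var[X; μ] + 2 * ∫ x, X x * (Y x - X x) ∂μ +
        ∫ x, (Y x - X x) ^ 2 ∂μ := by
      rw [variance_eq_sub hX, variance_eq_sub hY2, hmean]
      have hXD : Integrable (fun x => X x * (Y x - X x)) μ := hX.integrable_mul hD
      have : ∫ x, (Y x) ^ 2 ∂μ = ∫ x, (X x) ^ 2 ∂μ + 2 * ∫ x, X x * (Y x - X x) ∂μ +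
          ∫ x, (Y x - X x) ^ 2 ∂μ := by
        have i1 := hX.integrable_sq
        have i2 := hD.integrable_sq
        have i3 := hXD.const_mul 2
        have i4 : Integrable (fun x => X x ^ 2 + 2 * (X x * (Y x - X x))) μ := i1.add i3
        rw [← integral_const_mul, ← integral_add i1 i3, ← integral_add i4 i2]
        exact integral_congr_ae (.of_forall fun x => by ring)
      simp only [Pi.pow_apply]
      linarith
    have hsq : 0 ≤ ∫ x, (Y x - X x) ^ 2 ∂μ := integral_nonneg fun x => sq_nonneg _
    rw [← ofReal_variance hX, ← ofReal_variance hY2]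
    refine ⟨ENNReal.ofReal_le_ofReal (by linarith), fun hle => ?_⟩
    rw [ENNReal.ofReal_le_ofReal_iff (variance_nonneg _ _)] at hle
    have h0 : ∫ x, (Y x - X x) ^ 2 ∂μ = 0 := by linarith
    rw [integral_eq_zero_iff_of_nonneg (fun x => sq_nonneg _) hD.integrable_sq] at h0
    filter_upwards [h0] with x hx
    have : Y x - X x = 0 := by simpa using hx
    linarith
  · rw [evariance_eq_top hY.aestronglyMeasurable hY2]
    exact ⟨le_top, fun h => absurd (evariance_lt_top hX) (not_lt.2 h)⟩

end Variance

/-! ### Superlevel sets of the hull's slope -/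

section Superlevel

variable {p τ m : ℝ}

/-- Up to null sets, the superlevel sets of `slope` are initial intervals of `(0, 1]`, and each ends
where the hull is the curve or at `reach`. -/
lemma exists_superlevel_slope {t : ℝ} (hτ : 0 < τ) (hm : 0 ≤ m) (ht : 0 ≤ t) :
    ∃ s ∈ Set.Icc (0 : ℝ) 1, (s ≤ contact p τ m ∨ s = reach τ m) ∧
      ({u | t < slope p τ m u} ∩ Set.Ioc 0 1 : Set ℝ) =ᵐ[volume] Set.Ioc 0 s := by
  have hba := contact_le_reach (p := p) hτ hm
  have ha1 := reach_le_one (τ := τ) (m := m)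
  have sandwich : ∀ s, Set.Ioo 0 s ⊆ {u | t < slope p τ m u} ∩ Set.Ioc 0 1 →
      {u | t < slope p τ m u} ∩ Set.Ioc 0 1 ⊆ Set.Ioc 0 s →
      ({u | t < slope p τ m u} ∩ Set.Ioc 0 1 : Set ℝ) =ᵐ[volume] Set.Ioc 0 s :=
    fun s h1 h2 => h2.eventuallyLE.antisymm (Ioo_ae_eq_Ioc.symm.le.trans h1.eventuallyLE)
  rcases lt_or_ge t (chord p τ m) with hc | hc
  · refine ⟨reach τ m, ⟨reach_nonneg hτ hm, ha1⟩, .inr rfl, sandwich _ ?_ ?_⟩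
    · refine fun u hu => ⟨hc.trans_le ?_, hu.1, hu.2.le.trans ha1⟩
      rcases le_total u (contact p τ m) with h | h
      · exact chord_le_slope hτ hm hu.1 h
      · rw [slope_of_contact_le h hu.2.le]
    · refine fun u hu => ⟨hu.2.1, ?_⟩
      by_contra! h
      have := hu.1
      rw [Set.mem_ofPred_eq, slope_of_reach_lt hτ hm h] at this
      linarith
  · set T : Set ℝ := {u | t < slope p τ m u} ∩ Set.Ioc 0 1
    have hTb : ∀ u ∈ T, u < contact p τ m := by
      intro u hu
      by_contra! h
      have h1 : t < slope p τ m u := hu.1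
      rw [slope, if_neg (not_lt.2 h)] at h1
      split_ifs at h1 <;> linarith
    have hsb : sSup T ≤ contact p τ m :=
      Real.sSup_le (fun u hu => (hTb u hu).le) (contact_nonneg hτ hm)
    have hbdd : BddAbove T := ⟨_, fun u hu => (hTb u hu).le⟩
    refine ⟨sSup T, ⟨Real.sSup_nonneg fun u hu => hu.2.1.le, hsb.trans (hba.trans ha1)⟩,
      .inl hsb, sandwich _ ?_ fun u hu => ⟨hu.2.1, le_csSup hbdd hu⟩⟩
    intro u hu
    have hne : T.Nonempty := by
      by_contra h
      rw [Set.not_nonempty_iff_eq_empty] at h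
      have := hu.1.trans hu.2
      rw [h, Real.sSup_empty] at this
      exact lt_irrefl _ this
    obtain ⟨w, hw, huw⟩ := exists_lt_of_lt_csSup hne hu.2
    exact ⟨lt_of_lt_of_le hw.1 (slope_anti_of_le_contact hτ hm hu.1 huw.le (hTb w hw).le),
      hu.1, huw.le.trans hw.2.2⟩

end Superlevel

/-! ### Optimality of the U estimator -/

instance : IsProbabilityMeasure seedLaw := ⟨by simp [seedLaw]⟩

lemma integral_seedLaw (k : ℝ → ℝ) : ∫ u, k u ∂seedLaw = ∫ u in (0 : ℝ)..1, k u :=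
  (intervalIntegral.integral_of_le zero_le_one).symm

lemma ae_seedLaw_of_forall {P : ℝ → Prop} (h : ∀ u ∈ Set.Ioc (0 : ℝ) 1, P u) :
    ∀ᵐ u ∂seedLaw, P u :=
  (ae_restrict_iff' measurableSet_Ioc).2 (.of_forall h)

section Optimality

variable {r : ℕ} {p τ : ℝ}

lemma IsUnbiased.intervalIntegrable {g : Outcome r → ℝ} (hg : IsUnbiased p τ g) {v : Fin r → ℝ}
    (hv : ∀ i, 0 ≤ v i) {x y : ℝ} (hx : x ∈ Set.Icc (0 : ℝ) 1) (hy : y ∈ Set.Icc (0 : ℝ) 1) :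
    IntervalIntegrable (fun u => g (outcome τ u v)) volume x y := by
  rw [intervalIntegrable_iff]
  exact IntegrableOn.mono_set (hg v hv).1
    (Set.Ioc_subset_Ioc (le_min hx.1 hy.1) (max_le hx.2 hy.2))

/-- What a nonnegative unbiased estimator accumulates on the seeds above `ζ` is at most the range
of any data that are consistent with the outcome at `ζ`. -/
lemma IsUnbiased.integral_le_lowerBound {g : Outcome r → ℝ} (hg0 : IsNonneg τ g)
    (hg : IsUnbiased p τ g) (hτ : 0 ≤ τ) {v : Fin r → ℝ} (hv : ∀ i, 0 ≤ v i) {ζ : ℝ}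
    (hζ : ζ ∈ Set.Ioc (0 : ℝ) 1) :
    ∫ u in ζ..1, g (outcome τ u v) ≤ lowerBound p τ (outcome τ ζ v) := by
  refine le_csInf ⟨_, Set.mem_image_of_mem _ (self_mem_consistent hv)⟩ ?_
  rintro _ ⟨z, hz, rfl⟩
  have hz0 := (mem_consistent.1 hz).1
  have hζ' : ζ ∈ Set.Icc (0 : ℝ) 1 := Set.Ioc_subset_Icc_self hζ
  rw [← (hg z hz0).2, integral_seedLaw, ← intervalIntegral.integral_add_adjacent_intervals
    (hg.intervalIntegrable hz0 ⟨le_rfl, zero_le_one⟩ hζ')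
    (hg.intervalIntegrable hz0 hζ' ⟨zero_le_one, le_rfl⟩),
    intervalIntegral.integral_congr_Ioo_of_le (f := fun u => g (outcome τ u v))
      (g := fun u => g (outcome τ u z)) hζ.2 fun u hu => by
        simp only [outcome_eq_of_consistent hτ hz hu.1.le]]
  have : 0 ≤ ∫ u in (0 : ℝ)..ζ, g (outcome τ u z) := by
    rw [intervalIntegral.integral_of_le hζ.1.le]
    exact setIntegral_nonneg measurableSet_Ioc fun u hu =>
      hg0 z hz0 u ⟨hu.1, hu.2.trans hζ.2⟩
  linarith

/-- Data with the entries equal to the minimum lowered to `0`. -/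
def zeroMin (v : Fin r → ℝ) : Fin r → ℝ := fun i => if v i = vmin v then 0 else v i

lemma zeroMin_nonneg {v : Fin r → ℝ} (hv : ∀ i, 0 ≤ v i) (i : Fin r) : 0 ≤ zeroMin v i := by
  unfold zeroMin; split_ifs
  exacts [le_rfl, hv i]

variable [Nonempty (Fin r)]

lemma memLp_uVal {m n : ℝ} (hp : 0 < p) (hτ : 0 ≤ τ) (hn : 0 ≤ n) (hnm : n ≤ m) :
    MemLp (uVal p τ m n) 2 seedLaw := by
  refine MemLp.of_bound measurable_uVal.aestronglyMeasurable
    (max (chord p τ m + p * τ * m ^ (p - 1)) (level p τ m n)) (ae_seedLaw_of_forall fun u hu => ?_)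
  rw [Real.norm_of_nonneg (uVal_nonneg hp hτ hn hnm)]
  exact uVal_le_bound hp hτ hn hnm hu.1.le

lemma integrable_uVal {m n : ℝ} (hp : 0 < p) (hτ : 0 ≤ τ) (hn : 0 ≤ n) (hnm : n ≤ m) :
    Integrable (uVal p τ m n) seedLaw :=
  (memLp_uVal hp hτ hn hnm).integrable one_le_two

lemma integral_sub_uVal {g : Outcome r → ℝ} (hg : IsUnbiased p τ g) (hp : 0 < p) (hτ : 0 ≤ τ)
    {v : Fin r → ℝ} (hv : ∀ i, 0 ≤ v i) :
    ∫ u, (g (outcome τ u v) - uVal p τ (vmax v) (vmin v) u) ∂seedLaw = 0 := by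
  have hn := vmin_nonneg hv
  have hnm := vmin_le_vmax v
  rw [integral_sub (hg v hv).1 (integrable_uVal hp hτ hn hnm), (hg v hv).2, integral_seedLaw,
    integral_uVal hp hτ hn hnm, rangeP, sub_self]

/-- The U estimate is constant while all entries are sampled, so an unbiased estimator that
agrees with it on the other seeds is uncorrelated with their difference. -/
lemma inner_nonneg_of_ae_eq {g : Outcome r → ℝ} (hg : IsUnbiased p τ g) (hp : 0 < p) (hτ : 0 ≤ τ)
    {v : Fin r → ℝ} (hv : ∀ i, 0 ≤ v i)
    (h : ∀ᵐ u ∂seedLaw, vmin v < τ * u → g (outcome τ u v) = uVal p τ (vmax v) (vmin v) u) :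
    0 ≤ ∫ u, uVal p τ (vmax v) (vmin v) u *
      (g (outcome τ u v) - uVal p τ (vmax v) (vmin v) u) ∂seedLaw := by
  refine le_of_eq (Eq.symm ?_)
  rw [integral_congr_ae (g := fun u => level p τ (vmax v) (vmin v) *
    (g (outcome τ u v) - uVal p τ (vmax v) (vmin v) u)), integral_const_mul,
    integral_sub_uVal hg hp hτ hv, mul_zero]
  filter_upwards [h] with u hu
  rcases lt_or_ge (vmin v) (τ * u) with h' | h'
  · rw [hu h', sub_self, mul_zero, mul_zero]
  · rw [uVal_of_le h']

/-- On data with minimum `0`, the accumulated estimates of `g` stay below the hull wherever a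
superlevel set of the U estimate ends. -/
lemma inner_nonneg_of_vmin_eq_zero {g : Outcome r → ℝ} (hg0 : IsNonneg τ g)
    (hg : IsUnbiased p τ g) (hp : 0 < p) (hτ : 0 ≤ τ) {v : Fin r → ℝ} (hv : ∀ i, 0 ≤ v i)
    (hmin : vmin v = 0) :
    0 ≤ ∫ u, uVal p τ (vmax v) (vmin v) u *
      (g (outcome τ u v) - uVal p τ (vmax v) (vmin v) u) ∂seedLaw := by
  rcases hτ.eq_or_lt with rfl | hτ'
  · exact inner_nonneg_of_ae_eq hg hp le_rfl hv
      (.of_forall fun u hu => by rw [hmin, zero_mul] at hu; exact absurd hu (lt_irrefl 0))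
  have hm := vmax_nonneg hv
  set m := vmax v
  have hU : ∀ u ∈ Set.Ioc (0 : ℝ) 1, uVal p τ m (vmin v) u = slope p τ m u :=
    fun u hu => uVal_of_lt (by rw [hmin]; exact mul_pos hτ' hu.1)
  have hUae := ae_seedLaw_of_forall hU
  rw [integral_congr_ae (g := fun u => slope p τ m u * (g (outcome τ u v) - slope p τ m u))
    (hUae.mono fun u hu => by simp only [hu])]
  have hIs : Integrable (slope p τ m) seedLaw :=
    (integrable_uVal hp hτ (vmin_nonneg hv) (vmin_le_vmax v)).congr hUae
  refine integral_mul_nonneg_of_superlevel (C := chord p τ m + p * τ * m ^ (p - 1))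
    measurable_slope (ae_seedLaw_of_forall fun u hu =>
      ⟨slope_nonneg hp hτ' hm, slope_le_bound hp hτ' hm hu.1.le⟩) ((hg v hv).1.sub hIs) ?_
  intro t ht
  obtain ⟨s, hs, hsend, hset⟩ := exists_superlevel_slope hτ' hm ht
  have h01 : (0 : ℝ) ∈ Set.Icc (0 : ℝ) 1 := ⟨le_rfl, zero_le_one⟩
  have h11 : (1 : ℝ) ∈ Set.Icc (0 : ℝ) 1 := ⟨zero_le_one, le_rfl⟩
  rw [seedLaw, Measure.restrict_restrict (measurableSet_lt measurable_const measurable_slope),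
    setIntegral_congr_set hset, ← intervalIntegral.integral_of_le hs.1,
    intervalIntegral.integral_sub (hg.intervalIntegrable hv h01 hs)
      (intervalIntegrable_slope hp hτ' hm le_rfl hs.1)]
  have eg := intervalIntegral.integral_add_adjacent_intervals
    (hg.intervalIntegrable hv h01 hs) (hg.intervalIntegrable hv hs h11)
  rw [← integral_seedLaw fun u => g (outcome τ u v), (hg v hv).2, rangeP, hmin, sub_zero] at eg
  have es := intervalIntegral.integral_add_adjacent_intervals
    (intervalIntegrable_slope hp hτ' hm le_rfl hs.1)
    (intervalIntegrable_slope (p := p) hp hτ' hm hs.1 zero_le_one)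
  rw [integral_slope hp hτ' hm le_rfl zero_le_one, integral_slope hp hτ' hm hs.1 hs.2,
    hull_zero hτ' hm] at es
  have key : ∫ u in s..1, g (outcome τ u v) ≤ hull p τ m s := by
    rcases hs.1.eq_or_lt with rfl | hs0
    · rw [hull_zero hτ' hm, ← integral_seedLaw fun u => g (outcome τ u v), (hg v hv).2, rangeP,
        hmin, sub_zero]
    have hle := (hg.integral_le_lowerBound hg0 hτ hv ⟨hs0, hs.2⟩).trans (lowerBound_le hp hv)
    rcases hsend with h | rfl
    · rwa [hull_of_le h, ← max_eq_right
        (curve_base_nonneg hτ' (h.trans (contact_le_reach hτ' hm)))]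
    · rw [hull_of_reach_le hp hτ' hm le_rfl]
      rcases reach_eq_one_or (m := m) hτ' with h | h
      · rw [h, intervalIntegral.integral_same]
      · rwa [h, max_self, Real.zero_rpow hp.ne'] at hle
  linarith

lemma vmin_zeroMin {v : Fin r → ℝ} (hv : ∀ i, 0 ≤ v i) : vmin (zeroMin v) = 0 := by
  obtain ⟨i, hi⟩ := exists_eq_vmin v
  have := vmin_le (zeroMin v) i
  rw [zeroMin, if_pos hi] at this
  exact le_antisymm this (le_vmin (zeroMin_nonneg hv))

lemma vmax_zeroMin {v : Fin r → ℝ} (hv : ∀ i, 0 ≤ v i) (h : vmin v < vmax v) :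
    vmax (zeroMin v) = vmax v := by
  apply le_antisymm
  · refine vmax_le fun i => ?_
    unfold zeroMin; split_ifs
    exacts [vmax_nonneg hv, le_vmax v i]
  · obtain ⟨i, hi⟩ := exists_eq_vmax v
    have := le_vmax (zeroMin v) i
    rwa [zeroMin, if_neg (by rw [hi]; exact h.ne'), hi] at this

lemma outcome_zeroMin {v : Fin r → ℝ} {u : ℝ} (hv : ∀ i, 0 ≤ v i) (h : vmin v < τ * u) :
    outcome τ u (zeroMin v) = outcome τ u v := by
  simp only [outcome, Outcome.mk.injEq, true_and]
  funext i
  unfold zeroMin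
  split_ifs with h1 h2 h3 <;> first | rfl | (have := vmin_nonneg hv; linarith)

/-- Lowering the minimum to `0` enlarges the range and does not change the outcomes at seeds where
the minimum is not sampled. As the U estimator is the unique optimum for the lowered data, an
estimator that competes with it there agrees with it on these seeds. -/
theorem evariance_uVal_le {g : Outcome r → ℝ} (hg0 : IsNonneg τ g) (hg : IsUnbiased p τ g)
    (hp : 0 < p) (hτ : 0 ≤ τ) {v : Fin r → ℝ} (hv : ∀ i, 0 ≤ v i)
    (H : ∀ z : Fin r → ℝ, (∀ i, 0 ≤ z i) → vmin z = 0 → rangeP p v < rangeP p z →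
      estVar τ g z ≤ evariance (uVal p τ (vmax z) (vmin z)) seedLaw) :
    evariance (uVal p τ (vmax v) (vmin v)) seedLaw ≤ estVar τ g v := by
  have hopt : ∀ z : Fin r → ℝ, (∀ i, 0 ≤ z i) →
      0 ≤ ∫ u, uVal p τ (vmax z) (vmin z) u *
        (g (outcome τ u z) - uVal p τ (vmax z) (vmin z) u) ∂seedLaw →
      evariance (uVal p τ (vmax z) (vmin z)) seedLaw ≤ estVar τ g z ∧
        (estVar τ g z ≤ evariance (uVal p τ (vmax z) (vmin z)) seedLaw →
          (fun u => g (outcome τ u z)) =ᵐ[seedLaw] uVal p τ (vmax z) (vmin z)) := by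
    intro z hz hi
    have hn := vmin_nonneg hz
    have hnm := vmin_le_vmax z
    refine evariance_le_and_ae_eq (memLp_uVal hp hτ hn hnm) (hg z hz).1 ?_ hi
    rw [(hg z hz).2, integral_seedLaw, integral_uVal hp hτ hn hnm, rangeP]
  have hn := vmin_nonneg hv
  have hnm := vmin_le_vmax v
  rcases hn.eq_or_lt with h0 | hpos
  · exact (hopt v hv (inner_nonneg_of_vmin_eq_zero hg0 hg hp hτ hv h0.symm)).1
  refine (hopt v hv (inner_nonneg_of_ae_eq hg hp hτ hv ?_)).1
  rcases hnm.eq_or_lt with heq | hlt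
  · -- The range is zero, hence so is every nonnegative unbiased estimate.
    have hz : ∀ k : ℝ → ℝ, 0 ≤ᵐ[seedLaw] k → Integrable k seedLaw →
        ∫ u, k u ∂seedLaw = rangeP p v → k =ᵐ[seedLaw] 0 := by
      intro k hk hki hk2
      rw [rangeP, heq, sub_self, Real.zero_rpow hp.ne'] at hk2
      exact (integral_eq_zero_iff_of_nonneg_ae hk hki).1 hk2
    have h1 := hz _ (ae_seedLaw_of_forall (hg0 v hv)) (hg v hv).1 (hg v hv).2
    have h2 := hz _ (.of_forall fun u => uVal_nonneg hp hτ hn hnm)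
      (integrable_uVal hp hτ hn hnm) (by rw [integral_seedLaw, integral_uVal hp hτ hn hnm, rangeP])
    filter_upwards [h1, h2] with u h1 h2 _
    rw [h1, h2]
  · have hz := zeroMin_nonneg hv
    have hR : rangeP p v < rangeP p (zeroMin v) := by
      rw [rangeP, rangeP, vmin_zeroMin hv, vmax_zeroMin hv hlt]
      exact Real.rpow_lt_rpow (by linarith) (by linarith) hp
    have := (hopt _ hz (inner_nonneg_of_vmin_eq_zero hg0 hg hp hτ hz (vmin_zeroMin hv))).2
      (H _ hz (vmin_zeroMin hv) hR)
    filter_upwards [this, ae_seedLaw_of_forall (P := fun u => 0 < u) fun u hu => hu.1]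
      with u hu hu0 hlt'
    rw [outcome_zeroMin hv hlt', vmin_zeroMin hv, vmax_zeroMin hv hlt] at hu
    rw [hu, uVal_of_lt (hn.trans_lt hlt'), uVal_of_lt hlt']

end Optimality

/-! ### The case-based estimator -/

section Cases

variable {r : ℕ} {p τ : ℝ}

/-- `rangeU` at an outcome where some entries are sampled and others are not. -/
lemma rangeU_partial {ζ : ℝ} {v : Fin r → ℝ} [Nonempty (Fin r)] (hτ : 0 < τ)
    (h0 : 0 < ζ) (h1 : ζ ≤ 1) (hn : vmin v < τ * ζ) (hm : τ * ζ ≤ vmax v) :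
    rangeU p τ (outcome τ ζ v) = slope p τ (vmax v) ζ := by
  have hcard : ¬ (outcome τ ζ v).sampled.card = 0 :=
    fun h => absurd (card_sampled_eq_zero_iff.1 h) (not_lt.2 hm)
  have e : (outcome τ ζ v).seed = ζ := rfl
  have hζ := le_reach hτ hm h1
  unfold rangeU
  simp only [e, iSup_sampled hm, if_neg hcard, if_pos (card_sampled_lt_iff.2 hn),
    if_neg (not_le.2 hτ), if_true, zero_div, mul_pos h0 hτ]
  generalize vmax v = m at *
  have hm0 : 0 < m := (mul_pos hτ h0).trans_le hm
  split_ifs with hp1 hmτ hη hζη hζη'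
  · have hb : contact p τ m = 0 := if_pos hp1
    rw [slope_of_contact_le (hb.trans_le h0.le) hζ, chord, hb, reach]
    have : min m τ = τ * min (m / τ) 1 := by
      rw [mul_min_of_nonneg _ _ hτ.le, mul_one]; field_simp
    rw [this]
    have : 0 < min (m / τ) 1 := by positivity
    generalize min (m / τ) 1 = a at *
    simp only [mul_zero, sub_zero]
    field_simp
  · push Not at hp1
    rw [slope_of_le hτ hm0.le h0, mul_comm τ ζ]
    rw [contact, if_neg (not_le.2 hp1), if_pos hmτ]
    rwa [reach_of_le hτ hmτ] at hζ
  · push Not at hp1 hmτ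
    have hb := contact_eq_tangency hp1 hmτ hη.1
    rw [slope_of_contact_le (hb.trans_le ((le_max_left _ _).trans hζη)) hζ, chord, hb,
      reach_of_ge hτ hmτ.le, mul_comm τ]
  · push Not at hp1 hmτ
    rw [slope_of_le hτ hm0.le h0, mul_comm τ ζ]
    rw [contact_eq_tangency hp1 hmτ hη.1]
    exact hζη'.2.le
  · exfalso
    linarith [hη.1, h0]
  · exfalso
    push Not at hζη
    rcases lt_max_iff.1 hζη with h | h
    · exact hζη' ⟨h0, h⟩
    · linarith
  · push Not at hp1 hmτ
    have hlt : (p * τ - m) / ((p - 1) * τ) < 1 :=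
      (div_lt_one (mul_pos (by linarith) hτ)).2 (by linarith)
    have hb := contact_eq_zero (p := p) hmτ (by
      by_contra! h
      exact hη ⟨h, hlt⟩)
    rw [slope_of_contact_le (hb.trans_le h0.le) hζ, chord, hb, reach_of_ge hτ hmτ.le]
    simp

/-- `rangeU` at an outcome where all entries are sampled. -/
lemma rangeU_full {ζ : ℝ} {v : Fin r → ℝ} [Nonempty (Fin r)] (hp : 0 < p) (hτ : 0 ≤ τ)
    (h0 : 0 < ζ) (h1 : ζ ≤ 1) (hv : ∀ i, 0 ≤ v i) (hn : τ * ζ ≤ vmin v) :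
    (¬ IsTie p τ ζ v → rangeU p τ (outcome τ ζ v) = level p τ (vmax v) (vmin v)) ∧
      (IsTie p τ ζ v → rangeU p τ (outcome τ ζ v) = slope p τ (vmax v) ζ) := by
  have hnm := vmin_le_vmax v
  have hm := hn.trans hnm
  have hcard : ¬ (outcome τ ζ v).sampled.card = 0 :=
    fun h => absurd (card_sampled_eq_zero_iff.1 h) (not_lt.2 hm)
  have e : (outcome τ ζ v).seed = ζ := rfl
  have hn0 := vmin_nonneg hv
  unfold rangeU IsTie
  simp only [e, iSup_sampled hm, iInf_sampled hn, if_neg hcard,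
    if_neg (fun h => absurd (card_sampled_lt_iff.1 h) (not_lt.2 hn))]
  generalize vmax v = m at *
  generalize vmin v = n at *
  by_cases hnτ : τ ≤ n
  · rw [if_pos hnτ, level_of_le hnτ]
    refine ⟨fun _ => rfl, fun ⟨_, _, _, h4, h5, _⟩ => ?_⟩
    have : 0 < τ := hτ.lt_of_ne fun h => by
      subst h; linarith
    nlinarith
  push Not at hnτ
  have hτ' : 0 < τ := hn0.trans_lt hnτ
  have hnpos : 0 < n := (mul_pos hτ' h0).trans_le hn
  have hmpos : 0 < m := hnpos.trans_le hnm
  have hd0 : 0 < n / τ := by positivity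
  have hd1 : n / τ ≤ 1 := (div_le_one hτ').2 hnτ.le
  have e1 : τ * (n / τ) = n := by field_simp
  have hda : n / τ ≤ reach τ m := le_reach hτ' (e1.trans_le hnm) hd1
  have hζd : ζ ≤ n / τ := (le_div_iff₀ hτ').2 (by linarith)
  have hlev : level p τ m n = ((m - n) ^ p - hull p τ m (n / τ)) / (n / τ) :=
    if_neg (not_le.2 hnτ)
  rw [if_neg (not_le.2 hnτ)]
  by_cases hp1 : p ≤ 1
  · refine ⟨fun _ => ?_, fun h => absurd h.1 (not_lt.2 hp1)⟩
    have hb : contact p τ m = 0 := if_pos hp1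
    have : min m τ = τ * reach τ m := by
      rw [reach, mul_min_of_nonneg _ _ hτ, mul_one]; field_simp
    have ha : 0 < reach τ m := hd0.trans_le hda
    rw [if_pos hp1, if_neg hnpos.ne', hlev,
      hull_of_contact_le hp hτ' (hb.trans_le hd0.le) hda, chord, hb, this]
    simp only [mul_zero, sub_zero]
    field_simp
  push Not at hp1
  rw [if_neg (not_le.2 hp1)]
  -- If the hull at `n / τ` is still the curve, nothing remains to be estimated.
  have hzero : n / τ ≤ contact p τ m → level p τ m n = 0 := fun h => by
    rw [hlev, hull_of_le h, e1, sub_self, zero_div]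
  by_cases hmτ : m ≤ τ
  · refine ⟨fun _ => ?_, fun h => absurd h.2.1 (not_lt.2 hmτ)⟩
    rw [if_pos hmτ, if_neg (by linarith), hzero]
    rw [contact, if_neg (not_le.2 hp1), if_pos hmτ]
    gcongr
  push Not at hmτ
  rw [if_neg (not_le.2 hmτ)]
  have hden : 0 < (p - 1) * τ := mul_pos (by linarith) hτ'
  have ha := reach_of_ge hτ' hmτ.le
  have hlt : (p * τ - m) / ((p - 1) * τ) < 1 := (div_lt_one hden).2 (by linarith)
  by_cases hη : 0 < (p * τ - m) / ((p - 1) * τ)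
  · have hb := contact_eq_tangency hp1 hmτ hη
    have hmp : m < p * τ := by
      have := (div_pos_iff_of_pos_right hden).1 hη
      linarith
    rw [if_pos ⟨hη, hlt⟩]
    constructor
    · intro htie
      have h2 : ¬ max ((p * τ - m) / ((p - 1) * τ)) (n / τ) ≤ ζ := by
        intro h
        have hζeq := le_antisymm hζd ((le_max_right _ _).trans h)
        refine htie ⟨hp1, hmτ, hmp, by rw [hζeq]; field_simp, ?_, (le_max_left _ _).trans h⟩
        rw [hζeq]
        exact (div_lt_one hτ').2 hnτ
      rw [if_neg h2, if_neg (fun h => absurd h.1 (not_lt.2 hζd))]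
      split_ifs with h3
      · rw [hzero (hb.symm ▸ h3.2)]
      · have h3' : contact p τ m ≤ n / τ := by
          rw [hb]
          by_contra! h
          exact h3 ⟨hζd, h.le⟩
        rw [hlev, hull_of_contact_le hp hτ' h3' hda, chord, ha, hb,
          mul_comm τ ((p * τ - m) / ((p - 1) * τ))]
        have : 0 < 1 - (p * τ - m) / ((p - 1) * τ) := by linarith
        generalize (m - (p * τ - m) / ((p - 1) * τ) * τ) ^ p = X
        generalize 1 - (p * τ - m) / ((p - 1) * τ) = Y at *
        field_simp
    · rintro ⟨-, -, -, h4, h5, h6⟩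
      have hζeq : n / τ = ζ := by rw [← h4]; field_simp
      rw [if_pos (max_le h6 hζeq.le),
        slope_of_contact_le (hb.trans_le h6) (h1.trans ha.ge), chord, hb, ha, mul_comm τ]
  · rw [if_neg (fun h => hη h.1), if_neg (by linarith)]
    have hb := contact_eq_zero (p := p) hmτ (not_lt.1 hη)
    refine ⟨fun _ => ?_, fun h => absurd (div_pos (by linarith [h.2.2.1]) hden) hη⟩
    rw [hlev, hull_of_contact_le hp hτ' (hb.trans_le hd0.le) hda, chord, ha, hb]
    simp only [mul_zero, sub_zero, div_one]
    field_simp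

/-- The case-based estimator is the U estimator, except at ties, where its value is that of an
outcome in which the minimum is not sampled. -/
lemma rangeU_outcome {ζ : ℝ} {v : Fin r → ℝ} [Nonempty (Fin r)] (hp : 0 < p) (hτ : 0 ≤ τ)
    (hζ : ζ ∈ Set.Ioc (0 : ℝ) 1) (hv : ∀ i, 0 ≤ v i) :
    (¬ IsTie p τ ζ v → rangeU p τ (outcome τ ζ v) = uVal p τ (vmax v) (vmin v) ζ) ∧
      (IsTie p τ ζ v → rangeU p τ (outcome τ ζ v) = slope p τ (vmax v) ζ) := by
  rcases le_or_gt (τ * ζ) (vmin v) with hn | hn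
  · rw [uVal_of_le hn]
    exact rangeU_full hp hτ hζ.1 hζ.2 hv hn
  have hτ' := pos_of_vmin_lt hτ hv hn
  rw [uVal_of_lt hn]
  suffices h : rangeU p τ (outcome τ ζ v) = slope p τ (vmax v) ζ from ⟨fun _ => h, fun _ => h⟩
  rcases le_or_gt (τ * ζ) (vmax v) with hm | hm
  · exact rangeU_partial hτ' hζ.1 hζ.2 hn hm
  · rw [slope_of_reach_lt hτ' (vmax_nonneg hv)
      ((min_le_left _ _).trans_lt ((div_lt_iff₀ hτ').2 (by linarith)))]
    unfold rangeU
    simp only [if_pos (card_sampled_eq_zero_iff.2 hm)]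

lemma rangeU_ae_eq {v : Fin r → ℝ} [Nonempty (Fin r)] (hp : 0 < p) (hτ : 0 ≤ τ)
    (hv : ∀ i, 0 ≤ v i) :
    (fun u => rangeU p τ (outcome τ u v)) =ᵐ[seedLaw] uVal p τ (vmax v) (vmin v) := by
  have hne : ∀ᵐ u ∂seedLaw, u ≠ vmin v / τ :=
    ae_restrict_of_ae (Measure.ae_ne volume _)
  filter_upwards [hne, ae_seedLaw_of_forall fun u hu => rangeU_outcome (p := p) hp hτ hu hv]
    with u hu h
  refine h.1 fun ⟨_, h2, h3, h4, _⟩ => hu ?_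
  have hτ0 : τ ≠ 0 := by
    rintro rfl
    rw [mul_zero] at h3
    linarith
  rw [← h4]; field_simp

lemma estVar_rangeU {v : Fin r → ℝ} [Nonempty (Fin r)] (hp : 0 < p) (hτ : 0 ≤ τ)
    (hv : ∀ i, 0 ≤ v i) :
    estVar τ (rangeU p τ) v = evariance (uVal p τ (vmax v) (vmin v)) seedLaw :=
  evariance_congr (rangeU_ae_eq hp hτ hv)

lemma rangeU_isNonneg [Nonempty (Fin r)] (hp : 0 < p) (hτ : 0 ≤ τ) :
    IsNonneg τ (rangeU p τ : Outcome r → ℝ) := by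
  intro v hv u hu
  have h := rangeU_outcome (p := p) hp hτ hu hv
  by_cases ht : IsTie p τ u v
  · have hτ' : 0 < τ := by
      have := vmax_nonneg hv
      have h3 := ht.2.2.1
      by_contra h0
      obtain rfl : τ = 0 := le_antisymm (not_lt.1 h0) hτ
      linarith
    rw [h.2 ht]
    exact slope_nonneg hp hτ' (vmax_nonneg hv)
  · rw [h.1 ht]
    exact uVal_nonneg hp hτ (vmin_nonneg hv) (vmin_le_vmax v)

lemma rangeU_isUnbiased [Nonempty (Fin r)] (hp : 0 < p) (hτ : 0 ≤ τ) :
    IsUnbiased p τ (rangeU p τ : Outcome r → ℝ) := by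
  intro v hv
  have h := rangeU_ae_eq (p := p) hp hτ hv
  have hn := vmin_nonneg hv
  have hnm := vmin_le_vmax v
  refine ⟨(integrable_uVal hp hτ hn hnm).congr h.symm, ?_⟩
  rw [integral_congr_ae h, integral_seedLaw, integral_uVal hp hτ hn hnm, rangeP]

theorem rangeU_isRangeOrderOptimal [Nonempty (Fin r)] (hp : 0 < p) (hτ : 0 ≤ τ) :
    IsRangeOrderOptimal p τ (rangeU p τ : Outcome r → ℝ) := by
  rintro ⟨g, hg0, hg, v, hv, hlt, H⟩
  refine absurd hlt (not_lt.2 ?_)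
  rw [estVar_rangeU hp hτ hv]
  refine evariance_uVal_le hg0 hg hp hτ hv fun z hz _ hR => ?_
  rw [← estVar_rangeU hp hτ hz]
  exact H z hz hR

/-- Order optimality is stronger than admissibility. -/
lemma IsRangeOrderOptimal.isAdmissible {f : Outcome r → ℝ} (h : IsRangeOrderOptimal p τ f) :
    IsAdmissible p τ f :=
  fun ⟨g, hg0, hg, hle, v, hv, hlt⟩ => h ⟨g, hg0, hg, v, hv, hlt, fun z hz _ => hle z hz⟩

end Cases
end SharedSeed
end

theorem mainTheorem5 (r : ℕ) (hr : 2 ≤ r) (p τ : ℝ) (hp : 0 < p) (hτ : 0 ≤ τ) :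
    (∃ U : SharedSeed.Outcome r → ℝ,
      SharedSeed.SolvesUEquation p τ U ∧
      (∀ W : SharedSeed.Outcome r → ℝ, SharedSeed.SolvesUEquation p τ W →
        ∀ v : Fin r → ℝ, (∀ i, 0 ≤ v i) → ∀ ζ ∈ Set.Ioc (0 : ℝ) 1,
          W (SharedSeed.outcome τ ζ v) = U (SharedSeed.outcome τ ζ v)) ∧
      (∀ v : Fin r → ℝ, (∀ i, 0 ≤ v i) → ∀ ζ ∈ Set.Ioc (0 : ℝ) 1,
        ¬ SharedSeed.IsTie p τ ζ v →
          SharedSeed.rangeU p τ (SharedSeed.outcome τ ζ v) =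
            U (SharedSeed.outcome τ ζ v))) ∧
    SharedSeed.IsNonneg (r := r) τ (SharedSeed.rangeU p τ) ∧
    SharedSeed.IsUnbiased (r := r) p τ (SharedSeed.rangeU p τ) ∧
    (∀ v : Fin r → ℝ, (∀ i, 0 ≤ v i) →
      SharedSeed.estVar τ (SharedSeed.rangeU p τ) v < ⊤) ∧
    SharedSeed.IsAdmissible (r := r) p τ (SharedSeed.rangeU p τ) ∧
    SharedSeed.IsRangeOrderOptimal (r := r) p τ (SharedSeed.rangeU p τ) ∧
    (∀ v : Fin r → ℝ, (∀ i, 0 ≤ v i) → SharedSeed.vmin v = 0 →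
      ∀ g : SharedSeed.Outcome r → ℝ,
        SharedSeed.IsNonneg τ g → SharedSeed.IsUnbiased p τ g →
          SharedSeed.estVar τ (SharedSeed.rangeU p τ) v ≤ SharedSeed.estVar τ g v) := by
  open SharedSeed in
  have : Nonempty (Fin r) := ⟨⟨0, by omega⟩⟩
  have hopt := rangeU_isRangeOrderOptimal (r := r) hp hτ
  refine ⟨⟨uEst p τ, uEst_solves hp hτ, fun W hW v hv ζ hζ => hW.unique (uEst_solves hp hτ) hv hζ,
    fun v hv ζ hζ ht => ?_⟩, rangeU_isNonneg hp hτ, rangeU_isUnbiased hp hτ, fun v hv => ?_,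
    hopt.isAdmissible, hopt, fun v hv hmin g hg0 hg => ?_⟩
  · rw [uEst_outcome hτ hv hζ.1, (rangeU_outcome hp hτ hζ hv).1 ht]
  · rw [estVar_rangeU hp hτ hv]
    exact evariance_lt_top (memLp_uVal hp hτ (vmin_nonneg hv) (vmin_le_vmax v))
  · rw [estVar_rangeU hp hτ hv]
    have hn := vmin_nonneg hv
    have hnm := vmin_le_vmax v
    refine (evariance_le_and_ae_eq (memLp_uVal hp hτ hn hnm) (hg v hv).1 ?_
      (inner_nonneg_of_vmin_eq_zero hg0 hg hp hτ hv hmin)).1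
    rw [(hg v hv).2, integral_seedLaw, integral_uVal hp hτ hn hnm, rangeP]
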